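/- Let $\mathbb D=\{|z|<1\}$ and let $A^2(\mathbb D)$ be the Bergman space of holomorphic functions that are square-integrable for $d\mu=\frac1\pi\,dx\,dy$, with inner product $(f,g)_B=\int_{\mathbb D}\overline f g\,d\mu$. For $p\ge 0$ let $A^2(\mathbb D)^{\hat\otimes p}$ be the Hilbert space tensor power and $\mathrm{Sym}^pA^2(\mathbb D)$ the range in it of the symmetrization projection $f_1\otimes\cdots\otimes f_p\mapsto\frac1{p!}\sum_{\sigma\in S_p}f_{\sigma(1)}\otimes\cdots\otimes f_{\sigma(p)}$; let $\mathrm{Sym}\,A^2(\mathbb D)=\bigoplus_{p\ge0}\mathrm{Sym}^pA^2(\mathbb D)$ be the algebraic direct sum, and let $\mathcal H^k=\bigoplus_{p=0}^k\mathrm{Sym}^pA^2(\mathbb D)$, a Hilbert space. For an injective holomorphic map $\phi:\mathbb D\to\mathbb D$ put $F_\phi(z,w)=\frac{\phi'(z)\phi'(w)}{(\phi(z)-\phi(w))^2}-\frac1{(z-w)^2}$ and $(\mathcal J\phi)(z)=\overline{\phi(\bar z)}$, and let $\mathbb{CE}_2^{\mathrm{HS}}(1)$ be the monoid, under composition, of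 all such $\phi$ with $F_\phi\in L^2(\mathbb D\times\mathbb D)$. Define $T_\phi f=\phi'\cdot(f\circ\phi)$ on $A^2(\mathbb D)$ and $\rho_{\mathrm{cl}}(\phi)=T_{\mathcal J\phi}^*$, and extend $\rho_{\mathrm{cl}}(\phi)$ to the bounded operators $\rho_{\mathrm{cl}}(\phi)^{\hat\otimes p}$ on $A^2(\mathbb D)^{\hat\otimes p}$ (the identity for $p=0$). For $\phi\in\mathbb{CE}_2^{\mathrm{HS}}(1)$ let $\partial_\phi:A^2(\mathbb D)\hat\otimes A^2(\mathbb D)\to\mathbb C$ be the bounded functional $\partial_\phi(f\otimes g)=\int_{\mathbb D\times\mathbb D}F_\phi(\bar z,\bar w)f(z)g(w)\,d\mu(z)\,d\mu(w)$, and denote by $\partial_\phi$ also the operator of degree $-2$ on $\bigoplus_pA^2(\mathbb D)^{\hat\otimes p}$ that is bounded in each degree and satisfies $$\partial_\phi(a_1\otimes\cdots\otimes a_n)=\sum_{1\le i<j\le n}\partial_\phi(a_i\otimes a_j)\,a_1\otimes\cdots\hat a_i\cdots\hat a_j\cdots\otimes a_n$$ (zero for $n\le1$). Set $\rho(\phi)=\rho_{\mathrm{cl}}(\phi)\circ\exp(\partial_\phi)$.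 Then each $\rho(\phi)$ maps $\mathrm{Sym}\,A^2(\mathbb D)$ to itself, and $\phi\mapsto\rho(\phi)$ is a monoid homomorphism $\mathbb{CE}_2^{\mathrm{HS}}(1)\to\mathrm{End}(\mathrm{Sym}\,A^2(\mathbb D))$: $\rho(\phi\circ\psi)=\rho(\phi)\rho(\psi)$ and $\rho(\mathrm{id}_{\mathbb D})=\mathrm{id}$. For every $k\ge0$ and every $\phi\in\mathbb{CE}_2^{\mathrm{HS}}(1)$, $\rho(\phi)$ preserves $\mathcal H^k$ and restricts to a bounded linear operator on it. The restriction of $\rho$ to the group $\mathrm{PSU}(1,1)=\{z\mapsto e^{i\theta}\frac{z-\alpha}{1-\bar\alpha z}:\theta\in\mathbb R,\ |\alpha|<1\}\subset\mathbb{CE}_2^{\mathrm{HS}}(1)$ is, on each $\mathcal H^k$, a strongly continuous unitary representation. -/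

import Mathlib

noncomputable section

open scoped TensorProduct ComplexConjugate ENNReal Topology Complex.UnitDisc
open UniformSpace (Completion)
open MeasureTheory Metric Filter Complex

namespace BergmanCE

section HilbertTensor

/-- A bundled complex Hilbert space (used only to define tensor powers by recursion). -/
structure HilbertObj where
  carrier : Type
  [normed : NormedAddCommGroup carrier]
  [innerProd : InnerProductSpace ℂ carrier]
  [complete : CompleteSpace carrier]

attribute [instance] HilbertObj.normed HilbertObj.innerProd HilbertObj.complete

/-- The Hilbert space tensor product: the completion of the algebraic tensor product for
`⟪a ⊗ x, b ⊗ y⟫ = ⟪a, b⟫ * ⟪x, y⟫`. -/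
abbrev HTensor (H K : Type) [NormedAddCommGroup H] [InnerProductSpace ℂ H]
    [NormedAddCommGroup K] [InnerProductSpace ℂ K] : Type :=
  Completion (H ⊗[ℂ] K)

/-- The pure tensor `a ⊗ x` in the Hilbert space tensor product. -/
def htmul {H K : Type} [NormedAddCommGroup H] [InnerProductSpace ℂ H]
    [NormedAddCommGroup K] [InnerProductSpace ℂ K] (a : H) (x : K) : HTensor H K :=
  ((a ⊗ₜ[ℂ] x : H ⊗[ℂ] K) : Completion (H ⊗[ℂ] K))

variable {H K E F : Type} [NormedAddCommGroup H] [InnerProductSpace ℂ H]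
  [NormedAddCommGroup K] [InnerProductSpace ℂ K]
  [NormedAddCommGroup E] [InnerProductSpace ℂ E]
  [NormedAddCommGroup F] [InnerProductSpace ℂ F]

theorem inner_htmul (a b : H) (x y : K) :
    inner ℂ (htmul a x) (htmul b y) = inner ℂ a b * inner ℂ x y := by
  simp [htmul]

theorem dense_htmul {ι κ : Type*} (u : ι → H) (v : κ → K)
    (hu : (Submodule.span ℂ (Set.range u)).topologicalClosure = ⊤)
    (hv : (Submodule.span ℂ (Set.range v)).topologicalClosure = ⊤) :
    (Submodule.span ℂ (Set.range fun p : ι × κ => htmul (u p.1) (v p.2))).topologicalClosure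
      = ⊤ := by
  set S := (Submodule.span ℂ
    (Set.range fun p : ι × κ => htmul (u p.1) (v p.2))).topologicalClosure with hS
  have hcl : IsClosed (S : Set (HTensor H K)) := Submodule.isClosed_topologicalClosure _
  have hsub : ∀ p : ι × κ, htmul (u p.1) (v p.2) ∈ S := fun p =>
    Submodule.le_topologicalClosure _ (Submodule.subset_span ⟨p, rfl⟩)
  have hcont : Continuous fun p : H × K => htmul p.1 p.2 :=
    (Completion.continuous_coe _).comp TensorProduct.continuous_tmul
  have hadd1 : ∀ (a b : H) (x : K), htmul (a + b) x = htmul a x + htmul b x := by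
    intro a b x; simp [htmul, TensorProduct.add_tmul, Completion.coe_add]
  have hadd2 : ∀ (a : H) (x y : K), htmul a (x + y) = htmul a x + htmul a y := by
    intro a x y; simp [htmul, TensorProduct.tmul_add, Completion.coe_add]
  have hsm1 : ∀ (c : ℂ) (a : H) (x : K), htmul (c • a) x = c • htmul a x := by
    intro c a x; simp [htmul, ← TensorProduct.smul_tmul']
  have hsm2 : ∀ (c : ℂ) (a : H) (x : K), htmul a (c • x) = c • htmul a x := by
    intro c a x; simp [htmul]
  have h1 : ∀ (i : ι) (x : K), htmul (u i) x ∈ S := by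
    intro i x
    have hx : x ∈ closure ((Submodule.span ℂ (Set.range v) : Submodule ℂ K) : Set K) := by
      have : x ∈ (Submodule.span ℂ (Set.range v)).topologicalClosure := hv ▸ Submodule.mem_top
      exact this
    refine hcl.closure_subset_iff.2 ?_
      (map_mem_closure (f := fun x : K => htmul (u i) x) (t := (S : Set _)) (by fun_prop) hx ?_)
    · exact subset_rfl
    · intro y hy
      induction hy using Submodule.span_induction with
      | mem y hy => obtain ⟨k, rfl⟩ := hy; exact hsub (i, k)
      | zero => simp [htmul, Completion.coe_zero]
      | add y z _ _ hy hz => simpa [hadd2] using S.add_mem hy hz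
      | smul c y _ hy => simpa [hsm2] using S.smul_mem c hy
  have h2 : ∀ (a : H) (x : K), htmul a x ∈ S := by
    intro a x
    have hx : a ∈ closure ((Submodule.span ℂ (Set.range u) : Submodule ℂ H) : Set H) := by
      have : a ∈ (Submodule.span ℂ (Set.range u)).topologicalClosure := hu ▸ Submodule.mem_top
      exact this
    refine hcl.closure_subset_iff.2 ?_
      (map_mem_closure (f := fun a : H => htmul a x) (t := (S : Set _)) (by fun_prop) hx ?_)
    · exact subset_rfl
    · intro y hy
      induction hy using Submodule.span_induction with
      | mem y hy => obtain ⟨k, rfl⟩ := hy; exact h1 k x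
      | zero => simp [htmul, Completion.coe_zero]
      | add y z _ _ hy hz => simpa [hadd1] using S.add_mem hy hz
      | smul c y _ hy => simpa [hsm1] using S.smul_mem c hy
  refine (Submodule.eq_top_iff').2 fun t => ?_
  induction t using Completion.induction_on with
  | hp => exact hcl
  | ih t =>
    induction t using TensorProduct.induction_on with
    | zero => simp [Completion.coe_zero]
    | tmul a x => exact h2 a x
    | add s t hs ht => simpa [Completion.coe_add] using S.add_mem hs ht

/-- A family of vectors with the same Gram matrix as a family with dense span is its image under
a bounded (in fact isometric) operator. -/
theorem exists_clm_of_inner [CompleteSpace F] {ι : Type*} (a : ι → E) (b : ι → F)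
    (ha : (Submodule.span ℂ (Set.range a)).topologicalClosure = ⊤)
    (hab : ∀ i j, inner ℂ (b i) (b j) = inner ℂ (a i) (a j)) :
    ∃ W : E →L[ℂ] F, ∀ i, W (a i) = b i := by
  have hn : ∀ x : ι →₀ ℂ, ‖Finsupp.linearCombination ℂ b x‖
      = ‖Finsupp.linearCombination ℂ a x‖ := by
    intro x
    have : inner ℂ (Finsupp.linearCombination ℂ b x) (Finsupp.linearCombination ℂ b x)
        = inner ℂ (Finsupp.linearCombination ℂ a x) (Finsupp.linearCombination ℂ a x) := by
      simp only [Finsupp.linearCombination_apply, Finsupp.sum, sum_inner, inner_sum,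
        inner_smul_left, inner_smul_right, hab]
    rw [inner_self_eq_norm_sq_to_K, inner_self_eq_norm_sq_to_K] at this
    have h2 : ‖Finsupp.linearCombination ℂ b x‖ ^ 2
        = ‖Finsupp.linearCombination ℂ a x‖ ^ 2 := by exact_mod_cast this
    exact (sq_eq_sq₀ (norm_nonneg _) (norm_nonneg _)).1 h2
  have hd : DenseRange (Finsupp.linearCombination ℂ a) := by
    rw [DenseRange, ← LinearMap.coe_range, Finsupp.range_linearCombination]
    exact Submodule.dense_iff_topologicalClosure_eq_top.2 ha
  refine ⟨LinearMap.extendOfNorm (Finsupp.linearCombination ℂ b) (Finsupp.linearCombination ℂ a),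
    fun i => ?_⟩
  have := LinearMap.extendOfNorm_eq (f := Finsupp.linearCombination ℂ b) hd
    ⟨1, fun x => by rw [hn, one_mul]⟩ (Finsupp.single i 1)
  simpa using this

/-- Extension by continuity of a bounded operator on the algebraic tensor product. -/
theorem exists_htensor_extend [CompleteSpace F] (f : H ⊗[ℂ] K →L[ℂ] F) :
    ∃ g : HTensor H K →L[ℂ] F, ∀ a x, g (htmul a x) = f (a ⊗ₜ x) :=
  ⟨f.extend Completion.toComplL, fun a x =>
    f.extend_eq (e := Completion.toComplL) Completion.denseRange_coe
      (Completion.isUniformInducing_coe _) (a ⊗ₜ x)⟩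

theorem exists_htensor_lift [CompleteSpace F] (m : H → H → F)
    (hm : ∀ a b c d, inner ℂ (m a b) (m c d) = inner ℂ a c * inner ℂ b d) :
    ∃ W : HTensor H H →L[ℂ] F, ∀ a b, W (htmul a b) = m a b := by
  have htop : (Submodule.span ℂ (Set.range (id : H → H))).topologicalClosure = ⊤ := by
    rw [Set.range_id, Submodule.span_univ]
    exact top_unique (Submodule.le_topologicalClosure _)
  obtain ⟨W, hW⟩ := exists_clm_of_inner
    (fun p : H × H => (htmul (id p.1) (id p.2) : HTensor H H))
    (fun p : H × H => m p.1 p.2)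
    (dense_htmul (id : H → H) (id : H → H) htop htop)
    (fun p q => by rw [hm, inner_htmul]; rfl)
  exact ⟨W, fun f g => hW (f, g)⟩

variable [CompleteSpace H]

/-- The tensor powers of a Hilbert space: `ℂ`, `H ⊗ ℂ`, `H ⊗ (H ⊗ ℂ)`, … -/
def tensorPowObj (H : Type) [NormedAddCommGroup H] [InnerProductSpace ℂ H] [CompleteSpace H] :
    ℕ → HilbertObj
  | 0 => ⟨ℂ⟩
  | n + 1 => ⟨HTensor H (tensorPowObj H n).carrier⟩


/-- The `n`-th Hilbert space tensor power of `H`. -/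
abbrev TPow (H : Type) [NormedAddCommGroup H] [InnerProductSpace ℂ H] [CompleteSpace H]
    (n : ℕ) : Type :=
  (tensorPowObj H n).carrier

/-- The pure tensor `a 0 ⊗ a 1 ⊗ ⋯ ⊗ a (n - 1)`. -/
def tprod : ∀ {n : ℕ}, (Fin n → H) → TPow H n
  | 0, _ => (1 : ℂ)
  | _ + 1, a => htmul (a 0) (tprod (Fin.tail a))

theorem inner_tprod : ∀ {n : ℕ} (a b : Fin n → H),
    inner ℂ (tprod a) (tprod b) = ∏ i, inner ℂ (a i) (b i)
  | 0, _, _ => by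
    show inner ℂ (1 : ℂ) (1 : ℂ) = _
    simp
  | n + 1, a, b => by
    show inner ℂ (htmul (a 0) (tprod (Fin.tail a))) (htmul (b 0) (tprod (Fin.tail b))) = _
    rw [inner_htmul, inner_tprod, Fin.prod_univ_succ]
    rfl

theorem dense_tprod : ∀ n : ℕ,
    (Submodule.span ℂ (Set.range (tprod : (Fin n → H) → TPow H n))).topologicalClosure = ⊤
  | 0 => by
    refine top_unique fun x _ => Submodule.le_topologicalClosure _ ?_
    have : x = (show ℂ from x) • (tprod (Fin.elim0 : Fin 0 → H) : TPow H 0) :=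
      (mul_one (show ℂ from x)).symm
    rw [this]
    exact Submodule.smul_mem _ _ (Submodule.subset_span ⟨_, rfl⟩)
  | n + 1 => by
    refine top_unique ((dense_htmul (id : H → H) (tprod : (Fin n → H) → TPow H n)
      (by simp [Submodule.topologicalClosure_eq_top_iff]) (dense_tprod n)).ge.trans ?_)
    refine Submodule.topologicalClosure_mono (Submodule.span_mono ?_)
    rintro _ ⟨p, rfl⟩
    exact ⟨Fin.cons p.1 p.2, rfl⟩

/-- Bounded operators on `H^{⊗ n}` are determined by their values on pure tensors. -/
theorem clm_ext_tprod {n : ℕ} {S T : TPow H n →L[ℂ] E}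
    (h : ∀ a : Fin n → H, S (tprod a) = T (tprod a)) : S = T := by
  refine ContinuousLinearMap.ext_on (Submodule.dense_iff_topologicalClosure_eq_top.2
    (dense_tprod n)) ?_
  rintro _ ⟨a, rfl⟩
  exact h a

theorem exists_tensorMap (A : H →L[ℂ] H) : ∀ n : ℕ,
    ∃ L : TPow H n →L[ℂ] TPow H n, ∀ a : Fin n → H, L (tprod a) = tprod fun i => A (a i)
  | 0 => ⟨ContinuousLinearMap.id ℂ _, fun _ => rfl⟩
  | n + 1 => by
    obtain ⟨L, hL⟩ := exists_tensorMap A n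
    obtain ⟨g, hg⟩ := exists_htensor_extend (F := HTensor H (TPow H n))
      (Completion.toComplL.comp (TensorProduct.mapL A L))
    refine ⟨g, fun a => (hg _ _).trans ?_⟩
    simp only [ContinuousLinearMap.comp_apply, TensorProduct.mapL_tmul, hL]
    rfl

/-- `A ⊗ ⋯ ⊗ A`: the bounded operator on `H^{⊗ n}` with
`a₁ ⊗ ⋯ ⊗ aₙ ↦ A a₁ ⊗ ⋯ ⊗ A aₙ` (see `tensorMap_tprod`). -/
def tensorMap (A : H →L[ℂ] H) (n : ℕ) : TPow H n →L[ℂ] TPow H n :=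
  (exists_tensorMap A n).choose

theorem tensorMap_tprod (A : H →L[ℂ] H) {n : ℕ} (a : Fin n → H) :
    tensorMap A n (tprod a) = tprod fun i => A (a i) :=
  (exists_tensorMap A n).choose_spec a

theorem exists_contractPair (β : HTensor H H →L[ℂ] ℂ) {n : ℕ} (i : Fin (n + 2))
    (j : Fin (n + 1)) :
    ∃ L : TPow H (n + 2) →L[ℂ] TPow H n, ∀ a : Fin (n + 2) → H,
      L (tprod a) = β (htmul (a i) (a (i.succAbove j))) •
        tprod fun k => a (i.succAbove (j.succAbove k)) := by
  obtain ⟨W, hW⟩ := exists_clm_of_inner (tprod : (Fin (n + 2) → H) → TPow H (n + 2))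
    (fun a => (htmul (htmul (a i) (a (i.succAbove j)))
      (tprod fun k => a (i.succAbove (j.succAbove k))) : HTensor (HTensor H H) (TPow H n)))
    (dense_tprod _) (fun a b => by
      rw [inner_htmul, inner_htmul, inner_tprod, inner_tprod, Fin.prod_univ_succAbove _ i,
        Fin.prod_univ_succAbove _ j, mul_assoc])
  obtain ⟨g, hg⟩ := exists_htensor_extend (F := TPow H n)
    ((TensorProduct.lidIsometry ℂ (TPow H n)).toContinuousLinearEquiv.toContinuousLinearMap.comp
      (TensorProduct.mapL β (ContinuousLinearMap.id ℂ (TPow H n))))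
  refine ⟨g.comp W, fun a => ?_⟩
  rw [ContinuousLinearMap.comp_apply, hW, hg]
  simp

theorem exists_contract (β : HTensor H H →L[ℂ] ℂ) (n : ℕ) :
    ∃ L : TPow H (n + 2) →L[ℂ] TPow H n, ∀ a : Fin (n + 2) → H,
      L (tprod a) = ∑ i : Fin (n + 2), ∑ j : Fin (n + 1),
        if i < i.succAbove j then
          β (htmul (a i) (a (i.succAbove j))) • tprod fun k => a (i.succAbove (j.succAbove k))
        else 0 := by
  choose L hL using fun (i : Fin (n + 2)) (j : Fin (n + 1)) => exists_contractPair β i j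
  refine ⟨∑ i : Fin (n + 2), ∑ j : Fin (n + 1), if i < i.succAbove j then L i j else 0,
    fun a => ?_⟩
  simp only [_root_.sum_apply]
  refine Finset.sum_congr rfl fun i _ => Finset.sum_congr rfl fun j _ => ?_
  split_ifs
  · exact hL i j a
  · rfl

/-- Contraction of all pairs of factors against a bounded functional `β` on `H ⊗ H`: the bounded
operator with `a₁ ⊗ ⋯ ⊗ aₙ₊₂ ↦ ∑_{i < j} β (aᵢ ⊗ aⱼ) a₁ ⊗ ⋯ âᵢ ⋯ âⱼ ⋯ ⊗ aₙ₊₂`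
(see `contract_tprod`). -/
def contract (β : HTensor H H →L[ℂ] ℂ) (n : ℕ) : TPow H (n + 2) →L[ℂ] TPow H n :=
  (exists_contract β n).choose

/-- The pair of positions `i < j'` is written as `i`, `j' = i.succAbove j`; the remaining positions
are then enumerated in increasing order by `k ↦ i.succAbove (j.succAbove k)`. -/
theorem contract_tprod (β : HTensor H H →L[ℂ] ℂ) {n : ℕ} (a : Fin (n + 2) → H) :
    contract β n (tprod a) = ∑ i : Fin (n + 2), ∑ j : Fin (n + 1),
      if i < i.succAbove j then
        β (htmul (a i) (a (i.succAbove j))) • tprod fun k => a (i.succAbove (j.succAbove k))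
      else 0 :=
  (exists_contract β n).choose_spec a

/-! ### The symmetric algebra (algebraic direct sum of symmetric tensor powers) -/

/-- `⨁ₚ H^{⊗ p}` (algebraic direct sum of the Hilbert space tensor powers). -/
abbrev TensorAlg (H : Type) [NormedAddCommGroup H] [InnerProductSpace ℂ H] [CompleteSpace H] :
    Type :=
  DirectSum ℕ fun p => TPow H p

/-- The degree-wise extension of `A ⊗ ⋯ ⊗ A` to `⨁ₚ H^{⊗ p}`. -/
def tensorAlgMap (A : H →L[ℂ] H) : Module.End ℂ (TensorAlg H) :=
  DirectSum.lmap fun p => (tensorMap A p).toLinearMap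

/-- The degree `-2` operator on `⨁ₚ H^{⊗ p}` given by `contract β`, and by `0` in degrees
`0` and `1`. -/
def contractAlg (β : HTensor H H →L[ℂ] ℂ) : Module.End ℂ (TensorAlg H) :=
  DirectSum.toModule ℂ ℕ (TensorAlg H) fun p =>
    match p with
    | 0 => 0
    | 1 => 0
    | n + 2 => DirectSum.lof ℂ ℕ (fun p => TPow H p) n ∘ₗ (contract β n).toLinearMap

/-- `exp (contractAlg β) = ∑ₘ (contractAlg β) ^ m / m!`. In degree `p` the terms with `m > p`
vanish, as `contractAlg β` lowers degrees, so that the series is a finite sum there. -/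
def expContract (β : HTensor H H →L[ℂ] ℂ) : Module.End ℂ (TensorAlg H) :=
  DirectSum.toModule ℂ ℕ (TensorAlg H) fun p =>
    (∑ m ∈ Finset.range (p + 1), ((m.factorial : ℂ)⁻¹) • contractAlg β ^ m) ∘ₗ
      DirectSum.lof ℂ ℕ (fun p => TPow H p) p

theorem exists_symmetrizer (H : Type) [NormedAddCommGroup H] [InnerProductSpace ℂ H]
    [CompleteSpace H] (p : ℕ) : ∃ L : TPow H p →L[ℂ] TPow H p, ∀ a : Fin p → H,
      L (tprod a) = ((p.factorial : ℂ)⁻¹) • ∑ σ : Equiv.Perm (Fin p), tprod (a ∘ σ) := by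
  have h : ∀ σ : Equiv.Perm (Fin p), ∃ L : TPow H p →L[ℂ] TPow H p, ∀ a : Fin p → H,
      L (tprod a) = tprod (a ∘ σ) := fun σ =>
    exists_clm_of_inner tprod (fun a => tprod (a ∘ σ)) (dense_tprod p) fun a b => by
      rw [inner_tprod, inner_tprod]
      exact Equiv.prod_comp σ fun i => inner ℂ (a i) (b i)
  choose L hL using h
  refine ⟨((p.factorial : ℂ)⁻¹) • ∑ σ, L σ, fun a => ?_⟩
  simp only [_root_.smul_apply, _root_.sum_apply, hL]

/-- The symmetrization projection `Ŝ` on `H^{⊗ p}`: the bounded operator with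
`a₁ ⊗ ⋯ ⊗ aₚ ↦ (1 / p!) ∑_σ a_{σ 1} ⊗ ⋯ ⊗ a_{σ p}`. -/
def symmetrizer (H : Type) [NormedAddCommGroup H] [InnerProductSpace ℂ H] [CompleteSpace H]
    (p : ℕ) : TPow H p →L[ℂ] TPow H p :=
  (exists_symmetrizer H p).choose

theorem symmetrizer_tprod {p : ℕ} (a : Fin p → H) :
    symmetrizer H p (tprod a) =
      ((p.factorial : ℂ)⁻¹) • ∑ σ : Equiv.Perm (Fin p), tprod (a ∘ σ) :=
  (exists_symmetrizer H p).choose_spec a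

theorem symmetrizer_idem (p : ℕ) : IsIdempotentElem (symmetrizer H p) := by
  refine clm_ext_tprod fun a => ?_
  have h : ∀ σ : Equiv.Perm (Fin p),
      symmetrizer H p (tprod (a ∘ σ)) = symmetrizer H p (tprod a) := by
    intro σ
    rw [symmetrizer_tprod, symmetrizer_tprod]
    congr 1
    exact Fintype.sum_equiv (Equiv.mulLeft σ) _ _ fun τ => rfl
  change symmetrizer H p (symmetrizer H p (tprod a)) = _
  conv_lhs => rw [symmetrizer_tprod a]
  rw [map_smul, map_sum]
  simp only [h, Finset.sum_const, Finset.card_univ, Fintype.card_perm, Fintype.card_fin]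
  rw [← Nat.cast_smul_eq_nsmul ℂ, smul_smul,
    inv_mul_cancel₀ (Nat.cast_ne_zero.2 p.factorial_ne_zero), one_smul]

/-- The symmetric tensor power `Symᵖ H ⊂ H^{⊗ p}`: the range of the symmetrization projection. -/
def SymPow (H : Type) [NormedAddCommGroup H] [InnerProductSpace ℂ H] [CompleteSpace H]
    (p : ℕ) : Submodule ℂ (TPow H p) :=
  (symmetrizer H p).range

instance (p : ℕ) : CompleteSpace (SymPow H p) :=
  (ContinuousLinearMap.IsIdempotentElem.isClosed_range (symmetrizer_idem p)).completeSpace_coe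

/-- `Sym H = ⨁ₚ Symᵖ H` (algebraic direct sum). -/
abbrev FockSym (H : Type) [NormedAddCommGroup H] [InnerProductSpace ℂ H] [CompleteSpace H] :
    Type :=
  DirectSum ℕ fun p => SymPow H p

/-- The inclusion `Sym H ⊂ ⨁ₚ H^{⊗ p}`. -/
def FockSym.incl : FockSym H →ₗ[ℂ] TensorAlg H :=
  DirectSum.lmap fun p => (SymPow H p).subtype

/-- The Hilbert space `⨁_{p ≤ k} Symᵖ H` (orthogonal direct sum). -/
abbrev SymFil (H : Type) [NormedAddCommGroup H] [InnerProductSpace ℂ H] [CompleteSpace H]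
    (k : ℕ) : Type :=
  PiLp 2 fun p : Fin (k + 1) => SymPow H p

/-- The inclusion `⨁_{p ≤ k} Symᵖ H ⊂ Sym H`. -/
def SymFil.incl (k : ℕ) : SymFil H k →ₗ[ℂ] FockSym H where
  toFun x := ∑ p : Fin (k + 1), DirectSum.lof ℂ ℕ (fun p => SymPow H p) p (x p)
  map_add' x y := by simp [Finset.sum_add_distrib]
  map_smul' c x := by simp [Finset.smul_sum]

end HilbertTensor
section Bergman

/-- The normalized Lebesgue measure `(1 / π) dx dy` on the open unit disk. -/
def μD : Measure ℂ := ENNReal.ofReal Real.pi⁻¹ • (volume : Measure ℂ).restrict (ball 0 1)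

instance : IsProbabilityMeasure μD := ⟨by
  rw [μD, Measure.smul_apply, Measure.restrict_apply_univ, Complex.volume_ball]
  simp only [ENNReal.ofReal_one, one_pow, one_mul, smul_eq_mul]
  rw [show (NNReal.pi : ℝ≥0∞) = ENNReal.ofReal Real.pi from
    (ENNReal.ofReal_coe_nnreal (p := NNReal.pi)).symm, ← ENNReal.ofReal_mul (by positivity),
    inv_mul_cancel₀ Real.pi_ne_zero, ENNReal.ofReal_one]⟩

theorem ae_mu_iff {p : ℂ → Prop} : (∀ᵐ z ∂μD, p z) ↔ ∀ᵐ z ∂volume.restrict (ball (0 : ℂ) 1), p z :=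
  Measure.ae_ennreal_smul_measure_iff (by simp [Real.pi_pos])

theorem ae_mem_ball : ∀ᵐ z ∂μD, z ∈ ball (0 : ℂ) 1 :=
  ae_mu_iff.2 (ae_restrict_mem measurableSet_ball)

theorem aestronglyMeasurable_of_continuousOn {f : ℂ → ℂ} (hf : ContinuousOn f (ball 0 1)) :
    AEStronglyMeasurable f μD :=
  (hf.aestronglyMeasurable measurableSet_ball).smul_measure _

/-- Sub-mean value estimate over a small closed disk. -/
theorem enorm_le_lintegral_ball {f : ℂ → ℂ} (hf : DifferentiableOn ℂ f (ball 0 1)) {c : ℂ} {R : ℝ}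
    (hR : 0 < R) (hc : closedBall c R ⊆ ball 0 1) :
    ENNReal.ofReal (Real.pi * R ^ 2) * ‖f c‖ₑ ≤ ∫⁻ z in ball c R, ‖f z‖ₑ := by
  set g : ℂ → ℝ≥0∞ := (ball (0 : ℂ) R).indicator fun z => ‖f (c + z)‖ₑ with hg
  have hmaps : ∀ z ∈ ball (0 : ℂ) R, c + z ∈ ball (0 : ℂ) 1 := fun z hz =>
    hc (ball_subset_closedBall (by simpa [dist_eq_norm] using hz))
  have hgm : Measurable g := by
    have h1 : ContinuousOn (fun z => ‖f (c + z)‖ₑ) (ball (0 : ℂ) R) :=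
      (hf.continuousOn.comp (by fun_prop) hmaps).enorm
    classical
    have := h1.measurable_piecewise (g := fun _ => (0 : ℝ≥0∞)) continuousOn_const
      measurableSet_ball
    rw [hg]
    convert this using 1
    ext z; by_cases hz : z ∈ ball (0 : ℂ) R <;> simp [hz, Set.piecewise]
  have h0 : ∫⁻ z in ball c R, ‖f z‖ₑ = ∫⁻ z, g z := by
    rw [← lintegral_indicator measurableSet_ball,
      ← lintegral_add_left_eq_self _ c]
    refine lintegral_congr fun z => ?_
    by_cases hz : z ∈ ball (0 : ℂ) R
    · have : c + z ∈ ball c R := by simpa [dist_eq_norm] using hz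
      simp [hg, hz, this]
    · have : c + z ∉ ball c R := by simpa [dist_eq_norm] using hz
      simp [hg, hz, this]
  have hmean : ∀ r ∈ Set.Ioo 0 R, ENNReal.ofReal (2 * Real.pi) * ‖f c‖ₑ
      ≤ ∫⁻ θ in Set.Ioo (-Real.pi) Real.pi, g (Complex.polarCoord.symm (r, θ)) := by
    intro r hr
    have hsub : closedBall c r ⊆ ball 0 1 := (closedBall_subset_closedBall hr.2.le).trans hc
    have hav := DiffContOnCl.circleAverage (f := f) (c := c) (R := r) (by
      rw [abs_of_pos hr.1]
      refine DifferentiableOn.diffContOnCl (hf.mono ?_)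
      rwa [closure_ball _ hr.1.ne'])
    have hpi : (-Real.pi : ℝ) ≤ Real.pi := by linarith [Real.pi_pos]
    have hint : ∫ θ in Set.Ioo (-Real.pi) Real.pi, f (circleMap c r θ) = (2 * Real.pi) • f c := by
      rw [Real.circleAverage_eq_integral_add (-Real.pi)] at hav
      rw [← hav, smul_smul, mul_inv_cancel₀ (by positivity), one_smul,
        intervalIntegral.integral_comp_add_right (fun θ => f (circleMap c r θ)),
        ← integral_Ioc_eq_integral_Ioo, ← intervalIntegral.integral_of_le hpi]
      congr 1 <;> ring
    calc ENNReal.ofReal (2 * Real.pi) * ‖f c‖ₑ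
        = ‖∫ θ in Set.Ioo (-Real.pi) Real.pi, f (circleMap c r θ)‖ₑ := by
          rw [hint, enorm_smul, Real.enorm_of_nonneg (by positivity)]
      _ ≤ ∫⁻ θ in Set.Ioo (-Real.pi) Real.pi, ‖f (circleMap c r θ)‖ₑ :=
          enorm_integral_le_lintegral_enorm _
      _ = _ := by
          refine lintegral_congr fun θ => ?_
          have h1 : Complex.polarCoord.symm (r, θ) ∈ ball (0 : ℂ) R := by
            rw [mem_ball_zero_iff, Complex.norm_polarCoord_symm, abs_of_pos hr.1]
            exact hr.2
          rw [hg, Set.indicator_of_mem h1, circleMap, Complex.polarCoord_symm_apply,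
            Complex.exp_mul_I]
          simp
  have hpc : Measurable fun p : ℝ × ℝ => Complex.polarCoord.symm p := by
    simp only [Complex.polarCoord_symm_apply]
    fun_prop
  rw [h0, ← Complex.lintegral_comp_polarCoord_symm, polarCoord_target,
    Measure.volume_eq_prod, ← Measure.prod_restrict, lintegral_prod _ (by
      simp only [smul_eq_mul]
      exact (Measurable.mul (by fun_prop) (hgm.comp hpc)).aemeasurable)]
  calc ENNReal.ofReal (Real.pi * R ^ 2) * ‖f c‖ₑ
      = ∫⁻ r in Set.Ioo 0 R, ENNReal.ofReal r * (ENNReal.ofReal (2 * Real.pi) * ‖f c‖ₑ) := by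
        rw [lintegral_mul_const _ (by fun_prop), ← mul_assoc]
        congr 1
        rw [← ofReal_integral_eq_lintegral_ofReal, ← integral_Ioc_eq_integral_Ioo,
          ← intervalIntegral.integral_of_le hR.le, integral_id, ← ENNReal.ofReal_mul (by simp; positivity)]
        · congr 1; ring
        · exact (continuous_id.integrableOn_Icc).mono_set Set.Ioo_subset_Icc_self
        · exact (ae_restrict_mem measurableSet_Ioo).mono fun r hr => hr.1.le
    _ ≤ ∫⁻ r in Set.Ioo 0 R, ∫⁻ θ in Set.Ioo (-Real.pi) Real.pi,
          ENNReal.ofReal r • g (Complex.polarCoord.symm (r, θ)) := by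
        refine setLIntegral_mono' measurableSet_Ioo fun r hr => ?_
        simp only [smul_eq_mul]
        rw [lintegral_const_mul' _ _ ENNReal.ofReal_ne_top]
        gcongr
        exact hmean r hr
    _ ≤ _ := lintegral_mono_set Set.Ioo_subset_Ioi_self

/-- Point evaluations are bounded for the `L²` norm, locally uniformly. -/
theorem enorm_le_eLpNorm {f : ℂ → ℂ} (hf : DifferentiableOn ℂ f (ball 0 1)) {c : ℂ} {R : ℝ}
    (hR : 0 < R) (hc : closedBall c R ⊆ ball 0 1) :
    ENNReal.ofReal (R ^ 2) * ‖f c‖ₑ ≤ eLpNorm f 2 μD := by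
  have h1 := enorm_le_lintegral_ball hf hR hc
  have h2 : eLpNorm f 1 μD ≤ eLpNorm f 2 μD :=
    eLpNorm_le_eLpNorm_of_exponent_le (by norm_num)
      (aestronglyMeasurable_of_continuousOn hf.continuousOn)
  refine le_trans ?_ h2
  rw [eLpNorm_one_eq_lintegral_enorm, μD, lintegral_smul_measure]
  have h3 : ∫⁻ z in ball c R, ‖f z‖ₑ ≤ ∫⁻ z in ball 0 1, ‖f z‖ₑ :=
    lintegral_mono_set (ball_subset_closedBall.trans hc)
  calc ENNReal.ofReal (R ^ 2) * ‖f c‖ₑ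
      = ENNReal.ofReal Real.pi⁻¹ * (ENNReal.ofReal (Real.pi * R ^ 2) * ‖f c‖ₑ) := by
        rw [← mul_assoc, ← ENNReal.ofReal_mul (by positivity)]
        congr 2
        field_simp
    _ ≤ _ := by
        rw [smul_eq_mul]
        gcongr
        exact h1.trans h3

/-- The Bergman space `A²(𝔻)`: the square-integrable holomorphic functions on the unit disk, as a
subspace of `L²(𝔻, (1 / π) dx dy)`. -/
def A2 : Submodule ℂ (Lp ℂ 2 μD) where
  carrier := {f | ∃ g : ℂ → ℂ, DifferentiableOn ℂ g (ball 0 1) ∧ f =ᵐ[μD] g}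
  add_mem' := by
    rintro f₁ f₂ ⟨g₁, h₁, e₁⟩ ⟨g₂, h₂, e₂⟩
    exact ⟨g₁ + g₂, h₁.add h₂, (Lp.coeFn_add _ _).trans (e₁.add e₂)⟩
  zero_mem' := ⟨0, differentiableOn_const 0, Lp.coeFn_zero _ _ _⟩
  smul_mem' := by
    rintro c f ⟨g, h, e⟩
    exact ⟨c • g, h.const_smul c, (Lp.coeFn_smul _ _).trans (e.const_smul c)⟩

/-- The holomorphic function represented by an element of the Bergman space
(unique on the disk, see `hol_eqOn`). -/
def hol (f : A2) : ℂ → ℂ := f.2.choose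

theorem hol_differentiableOn (f : A2) : DifferentiableOn ℂ (hol f) (ball 0 1) :=
  f.2.choose_spec.1

theorem coe_ae_eq_hol (f : A2) : (f : Lp ℂ 2 μD) =ᵐ[μD] hol f := f.2.choose_spec.2

theorem eqOn_of_ae_eq {g h : ℂ → ℂ} (hg : ContinuousOn g (ball 0 1))
    (hh : ContinuousOn h (ball 0 1)) (e : g =ᵐ[μD] h) : Set.EqOn g h (ball 0 1) :=
  Measure.eqOn_open_of_ae_eq (μ := (volume : Measure ℂ)) (ae_mu_iff.1 e) isOpen_ball hg hh

theorem hol_eqOn (f : A2) {g : ℂ → ℂ} (hg : DifferentiableOn ℂ g (ball 0 1))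
    (e : (f : Lp ℂ 2 μD) =ᵐ[μD] g) : Set.EqOn (hol f) g (ball 0 1) :=
  eqOn_of_ae_eq (hol_differentiableOn f).continuousOn hg.continuousOn
    ((coe_ae_eq_hol f).symm.trans e)

theorem hol_add (f g : A2) : Set.EqOn (hol (f + g)) (hol f + hol g) (ball 0 1) :=
  hol_eqOn _ ((hol_differentiableOn f).add (hol_differentiableOn g))
    ((Lp.coeFn_add _ _).trans ((coe_ae_eq_hol f).add (coe_ae_eq_hol g)))

theorem hol_smul (c : ℂ) (f : A2) : Set.EqOn (hol (c • f)) (c • hol f) (ball 0 1) :=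
  hol_eqOn _ ((hol_differentiableOn f).const_smul c)
    ((Lp.coeFn_smul _ _).trans ((coe_ae_eq_hol f).const_smul c))

theorem norm_hol_le (f : A2) {c : ℂ} {R : ℝ} (hR : 0 < R) (hc : closedBall c R ⊆ ball 0 1) :
    ‖hol f c‖ ≤ (R ^ 2)⁻¹ * ‖f‖ := by
  have h := enorm_le_eLpNorm (hol_differentiableOn f) hR hc
  rw [← eLpNorm_congr_ae (coe_ae_eq_hol f), ← Lp.enorm_def, ← ofReal_norm, ← ofReal_norm,
    ← ENNReal.ofReal_mul (by positivity), ENNReal.ofReal_le_ofReal_iff (norm_nonneg _)] at h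
  rw [inv_mul_eq_div, le_div_iff₀ (by positivity), mul_comm]
  exact h

/-- The Bergman space is complete. -/
instance : CompleteSpace A2 := by
  refine Metric.complete_of_cauchySeq_tendsto fun u hu => ?_
  have hsub : ∀ m n, Set.EqOn (hol (u m - u n)) (hol (u m) - hol (u n)) (ball 0 1) := fun m n =>
    hol_eqOn _ ((hol_differentiableOn _).sub (hol_differentiableOn _))
      ((Lp.coeFn_sub _ _).trans ((coe_ae_eq_hol _).sub (coe_ae_eq_hol _)))
  -- local uniform Cauchy property
  have hloc : ∀ c ∈ ball (0 : ℂ) 1, ∃ r > 0, ball c r ⊆ ball 0 1 ∧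
      UniformCauchySeqOn (fun n => hol (u n)) atTop (ball c r) := by
    intro c hc
    rw [mem_ball_zero_iff] at hc
    set R := (1 - ‖c‖) / 3 with hR
    have hR0 : 0 < R := by rw [hR]; linarith
    have hball : ∀ z ∈ ball c R, closedBall z R ⊆ ball 0 1 := by
      intro z hz w hw
      rw [mem_ball, dist_eq_norm] at hz
      rw [mem_closedBall, dist_eq_norm] at hw
      rw [mem_ball_zero_iff]
      calc ‖w‖ = ‖(w - z) + (z - c) + c‖ := by ring_nf
        _ ≤ ‖w - z‖ + ‖z - c‖ + ‖c‖ := norm_add₃_le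
        _ < 1 := by rw [hR] at hz hw; linarith
    refine ⟨R, hR0, fun z hz => hball z hz (mem_closedBall_self hR0.le), ?_⟩
    rw [Metric.uniformCauchySeqOn_iff]
    intro ε hε
    obtain ⟨N, hN⟩ := Metric.cauchySeq_iff.1 hu (R ^ 2 * ε) (by positivity)
    refine ⟨N, fun m hm n hn z hz => ?_⟩
    have h1 := norm_hol_le (u m - u n) hR0 (hball z hz)
    have h2 := hN m hm n hn
    rw [hsub m n (hball z hz (mem_closedBall_self hR0.le))] at h1
    rw [dist_eq_norm] at h2 ⊢
    refine h1.trans_lt ?_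
    rw [inv_mul_eq_div, div_lt_iff₀ (by positivity), mul_comm]
    exact h2
  have hlim : ∀ z ∈ ball (0 : ℂ) 1, ∃ l, Tendsto (fun n => hol (u n) z) atTop (𝓝 l) := by
    intro z hz
    obtain ⟨r, hr, -, h⟩ := hloc z hz
    exact cauchySeq_tendsto_of_complete (h.cauchySeq (mem_ball_self hr))
  choose! g hg using hlim
  have hgd : DifferentiableOn ℂ g (ball 0 1) := by
    refine TendstoLocallyUniformlyOn.differentiableOn (φ := atTop)
      (F := fun n => hol (u n)) ?_ (.of_forall fun n => hol_differentiableOn _) isOpen_ball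
    refine tendstoLocallyUniformlyOn_of_forall_exists_nhds fun c hc => ?_
    obtain ⟨r, hr, hsubr, h⟩ := hloc c hc
    exact ⟨ball c r, mem_nhdsWithin_of_mem_nhds (ball_mem_nhds c hr),
      h.tendstoUniformlyOn_of_tendsto fun z hz => hg z (hsubr hz)⟩
  obtain ⟨f, hf⟩ := cauchySeq_tendsto_of_complete
    (u := fun n => ((u n : A2) : Lp ℂ 2 μD)) (by
      simpa [Function.comp_def] using (isometry_subtype_coe (s := (A2 : Set (Lp ℂ 2 μD)))).uniformContinuous.comp_cauchySeq hu)
  have hfg : f =ᵐ[μD] g := by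
    obtain ⟨ns, hns, hae⟩ := (tendstoInMeasure_of_tendsto_Lp hf).exists_seq_tendsto_ae
    have hall : ∀ᵐ z ∂μD, ∀ n, ((u n : A2) : Lp ℂ 2 μD) z = hol (u n) z :=
      ae_all_iff.2 fun n => coe_ae_eq_hol (u n)
    filter_upwards [hae, hall, ae_mem_ball] with z h1 h2 h3
    simp only [h2] at h1
    exact tendsto_nhds_unique h1 ((hg z h3).comp hns.tendsto_atTop)
  exact ⟨⟨f, g, hgd, hfg⟩, tendsto_subtype_rng.2 hf⟩

/-! ### Holomorphic disk embeddings -/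

/-- The extension by zero to `ℂ` of a self-map of the open unit disk. -/
def ext (φ : 𝔻 → 𝔻) (z : ℂ) : ℂ := if h : ‖z‖ < 1 then (φ (.mk z h) : ℂ) else 0

theorem ext_coe (φ : 𝔻 → 𝔻) (z : 𝔻) : ext φ z = φ z := by
  simp [ext, z.norm_lt_one]

theorem ext_mapsTo (φ : 𝔻 → 𝔻) : Set.MapsTo (ext φ) (ball 0 1) (ball 0 1) := by
  intro z hz
  lift z to 𝔻 using by simpa using hz
  rw [ext_coe, mem_ball_zero_iff]
  exact (φ z).norm_lt_one

theorem ext_injOn {φ : 𝔻 → 𝔻} (h : Function.Injective φ) : Set.InjOn (ext φ) (ball 0 1) := by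
  intro z hz w hw e
  lift z to 𝔻 using by simpa using hz
  lift w to 𝔻 using by simpa using hw
  rw [ext_coe, ext_coe, UnitDisc.coe_inj] at e
  rw [h e]

theorem ext_comp_eqOn (φ ψ : 𝔻 → 𝔻) : Set.EqOn (ext (φ ∘ ψ)) (ext φ ∘ ext ψ) (ball 0 1) := by
  intro z hz
  lift z to 𝔻 using by simpa using hz
  simp only [Function.comp_apply, ext_coe]

/-- The monoid (under composition) of injective holomorphic maps `𝔻 → 𝔻`. -/
def CEemb : Submonoid (Function.End 𝔻) where
  carrier := {φ | DifferentiableOn ℂ (ext φ) (ball 0 1) ∧ Function.Injective φ}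
  one_mem' := by
    refine ⟨differentiableOn_id.congr fun z hz => ?_, Function.injective_id⟩
    lift z to 𝔻 using by simpa using hz
    exact ext_coe _ z
  mul_mem' := by
    rintro φ ψ ⟨h₁, i₁⟩ ⟨h₂, i₂⟩
    exact ⟨(h₁.comp h₂ (ext_mapsTo ψ)).congr (ext_comp_eqOn φ ψ), i₁.comp i₂⟩

/-- The underlying function of a disk embedding, extended by zero to `ℂ`. -/
def fn (φ : CEemb) : ℂ → ℂ := ext φ.1

theorem fn_coe (φ : CEemb) (z : 𝔻) : (fn φ) z = (φ.1 z : 𝔻) := ext_coe _ z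

theorem fn_differentiableOn (φ : CEemb) : DifferentiableOn ℂ (fn φ) (ball 0 1) := φ.2.1

theorem fn_injOn (φ : CEemb) : Set.InjOn (fn φ) (ball 0 1) := ext_injOn φ.2.2

theorem fn_mapsTo (φ : CEemb) : Set.MapsTo (fn φ) (ball 0 1) (ball 0 1) := ext_mapsTo _

theorem fn_mul_eqOn (φ ψ : CEemb) : Set.EqOn (fn (φ * ψ)) ((fn φ) ∘ (fn ψ)) (ball 0 1) :=
  ext_comp_eqOn φ.1 ψ.1

theorem fn_differentiableOn_deriv (φ : CEemb) :
    DifferentiableOn ℂ (deriv (fn φ)) (ball 0 1) :=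
  (fn_differentiableOn φ).deriv isOpen_ball

theorem deriv_fn_mul (φ ψ : CEemb) {z : ℂ} (hz : z ∈ ball (0 : ℂ) 1) :
    deriv (fn (φ * ψ)) z = deriv (fn φ) ((fn ψ) z) * deriv (fn ψ) z := by
  have h : (fn (φ * ψ)) =ᶠ[𝓝 z] (fn φ) ∘ (fn ψ) :=
    (fn_mul_eqOn φ ψ).eventuallyEq_of_mem (isOpen_ball.mem_nhds hz)
  rw [h.deriv_eq]
  exact deriv_comp _ ((fn_differentiableOn φ).differentiableAt (isOpen_ball.mem_nhds ((fn_mapsTo ψ) hz)))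
    ((fn_differentiableOn ψ).differentiableAt (isOpen_ball.mem_nhds hz))

/-- `𝒥 φ (z) = conj (φ (conj z))`. -/
def conjJ (φ : CEemb) : CEemb :=
  ⟨fun z => star (φ.1 (star z)), by
    refine ⟨fun z hz => ?_, star_injective.comp (φ.2.2.comp star_injective)⟩
    have hz' : conj z ∈ ball (0 : ℂ) 1 := by simpa using hz
    have h := ((fn_differentiableOn φ).differentiableAt (isOpen_ball.mem_nhds hz')).conj_conj
    rw [Complex.conj_conj] at h
    refine (h.congr_of_eventuallyEq (Filter.eventuallyEq_of_mem (isOpen_ball.mem_nhds hz) ?_)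
      ).differentiableWithinAt
    intro w hw
    lift w to 𝔻 using by simpa using hw
    have : conj (w : ℂ) = ((star w : 𝔻) : ℂ) := rfl
    simp only [Function.comp_apply, this, ext_coe, fn_coe]
    rfl⟩

theorem fn_conjJ (φ : CEemb) : (fn (conjJ φ)) = conj ∘ (fn φ) ∘ conj := by
  ext z
  by_cases hz : ‖z‖ < 1
  · lift z to 𝔻 using hz
    have : conj (z : ℂ) = ((star z : 𝔻) : ℂ) := rfl
    simp only [Function.comp_apply, this, fn_coe]
    rfl
  · simp [fn, ext, hz]

/-- Change of variables along a disk embedding. -/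
theorem fn_lintegral_comp_le (φ : CEemb) (g : ℂ → ℝ≥0∞) :
    ∫⁻ z, ‖deriv (fn φ) z‖ₑ ^ 2 * g ((fn φ) z) ∂μD ≤ ∫⁻ z, g z ∂μD := by
  rw [μD, lintegral_smul_measure, lintegral_smul_measure, smul_eq_mul, smul_eq_mul]
  refine mul_le_mul_right ?_ _
  have h := lintegral_image_eq_lintegral_abs_det_fderiv_mul (volume : Measure ℂ)
    (s := ball (0 : ℂ) 1) (f := (fn φ))
    (f' := fun z => (ContinuousLinearMap.toSpanSingleton ℂ (deriv (fn φ) z)).restrictScalars ℝ)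
    measurableSet_ball (fun z hz =>
      (((fn_differentiableOn φ).differentiableAt (isOpen_ball.mem_nhds hz)).hasDerivAt.hasFDerivAt
        |>.restrictScalars ℝ).hasFDerivWithinAt) (fn_injOn φ) g
  have hdet : ∀ z, ENNReal.ofReal |((ContinuousLinearMap.toSpanSingleton ℂ
      (deriv (fn φ) z)).restrictScalars ℝ).det| = ‖deriv (fn φ) z‖ₑ ^ 2 := by
    intro z
    have : ((ContinuousLinearMap.toSpanSingleton ℂ
      (deriv (fn φ) z)).restrictScalars ℝ).det = ‖deriv (fn φ) z‖ ^ 2 := by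
      simp [ContinuousLinearMap.det, LinearMap.det_restrictScalars,
        Algebra.norm_complex_eq, Complex.normSq_eq_norm_sq]
    rw [this, abs_of_nonneg (by positivity), ENNReal.ofReal_pow (norm_nonneg _), ofReal_norm]
  simp only [hdet] at h
  rw [← h]
  exact lintegral_mono_set (fn_mapsTo φ).image_subset

theorem eLpNorm_two_sq {α : Type*} {m : MeasurableSpace α} (μ : Measure α) (f : α → ℂ) :
    eLpNorm f 2 μ ^ 2 = ∫⁻ x, ‖f x‖ₑ ^ 2 ∂μ := by
  have := eLpNorm_nnreal_pow_eq_lintegral (μ := μ) (f := f) (p := 2) (by norm_num)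
  simpa using this

theorem pull_aux (φ : CEemb) (f : A2) :
    DifferentiableOn ℂ (fun z => deriv (fn φ) z * hol f ((fn φ) z)) (ball 0 1) :=
  (fn_differentiableOn_deriv φ).mul ((hol_differentiableOn f).comp (fn_differentiableOn φ) (fn_mapsTo φ))

theorem eLpNorm_pull_le (φ : CEemb) (f : A2) :
    eLpNorm (fun z => deriv (fn φ) z * hol f ((fn φ) z)) 2 μD ≤ eLpNorm (f : Lp ℂ 2 μD) 2 μD := by
  rw [eLpNorm_congr_ae (coe_ae_eq_hol f), ← ENNReal.pow_le_pow_left_iff two_ne_zero,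
    eLpNorm_two_sq, eLpNorm_two_sq]
  simp only [enorm_mul, mul_pow]
  exact (fn_lintegral_comp_le φ) fun z => ‖hol f z‖ₑ ^ 2

theorem memLp_pull (φ : CEemb) (f : A2) :
    MemLp (fun z => deriv (fn φ) z * hol f ((fn φ) z)) 2 μD :=
  ⟨aestronglyMeasurable_of_continuousOn (pull_aux φ f).continuousOn,
    (eLpNorm_pull_le φ f).trans_lt (Lp.memLp (f : Lp ℂ 2 μD)).2⟩

/-- The bounded operator `T_φ f = φ' · (f ∘ φ)` on the Bergman space. -/
def T (φ : CEemb) : A2 →L[ℂ] A2 :=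
  LinearMap.mkContinuous
    { toFun := fun f => ⟨(memLp_pull φ f).toLp _, _, pull_aux φ f, (memLp_pull φ f).coeFn_toLp⟩
      map_add' := fun f g => by
        refine Subtype.ext (Lp.ext ?_)
        refine (memLp_pull φ (f + g)).coeFn_toLp.trans (EventuallyEq.trans ?_ (Lp.coeFn_add _ _).symm)
        filter_upwards [ae_mem_ball, (memLp_pull φ f).coeFn_toLp, (memLp_pull φ g).coeFn_toLp]
          with z hz h1 h2
        rw [Pi.add_apply, h1, h2, hol_add f g ((fn_mapsTo φ) hz), Pi.add_apply, mul_add]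
      map_smul' := fun c f => by
        refine Subtype.ext (Lp.ext ?_)
        refine (memLp_pull φ (c • f)).coeFn_toLp.trans (EventuallyEq.trans ?_ (Lp.coeFn_smul _ _).symm)
        filter_upwards [ae_mem_ball, (memLp_pull φ f).coeFn_toLp] with z hz h1
        rw [RingHom.id_apply, Pi.smul_apply, h1, hol_smul c f ((fn_mapsTo φ) hz), Pi.smul_apply,
          smul_eq_mul, smul_eq_mul, mul_left_comm] }
    1 fun f => by
      rw [one_mul]
      change ‖(memLp_pull φ f).toLp _‖ ≤ ‖(f : Lp ℂ 2 μD)‖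
      rw [Lp.norm_toLp, Lp.norm_def]
      exact ENNReal.toReal_mono (Lp.memLp (f : Lp ℂ 2 μD)).2.ne (eLpNorm_pull_le φ f)

/-- `ρ_cl(φ) = (T_{𝒥 φ})^*` on the Bergman space. -/
def rhoCl (φ : CEemb) : A2 →L[ℂ] A2 := ContinuousLinearMap.adjoint (T (conjJ φ))

/-! ### The cocycle and the Hilbert–Schmidt condition -/

/-- `F_φ(z, w) = φ'(z) φ'(w) / (φ(z) - φ(w))² - 1 / (z - w)²` (off the diagonal). -/
def F (φ : CEemb) (p : ℂ × ℂ) : ℂ :=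
  deriv (fn φ) p.1 * deriv (fn φ) p.2 / ((fn φ) p.1 - (fn φ) p.2) ^ 2 - 1 / (p.1 - p.2) ^ 2

theorem ae_prod_mem_ball :
    ∀ᵐ p ∂(μD.prod μD), p.1 ∈ ball (0 : ℂ) 1 ∧ p.2 ∈ ball (0 : ℂ) 1 :=
  (Measure.quasiMeasurePreserving_fst.ae ae_mem_ball).and
    (Measure.quasiMeasurePreserving_snd.ae ae_mem_ball)

theorem measurable_fn (φ : CEemb) : Measurable (fn φ) := by
  classical
  have := (fn_differentiableOn φ).continuousOn.measurable_piecewise (g := fun _ => (0 : ℂ))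
    continuousOn_const measurableSet_ball
  convert this using 1
  ext z
  by_cases hz : z ∈ ball (0 : ℂ) 1
  · simp [Set.piecewise, hz]
  · simp only [Set.piecewise, hz, if_false]
    simp only [mem_ball_zero_iff] at hz
    simp [fn, ext, hz]

theorem measurable_F (φ : CEemb) : Measurable (F φ) := by
  have h1 := measurable_fn φ
  have h2 := measurable_deriv (fn φ)
  unfold F
  fun_prop

theorem F_mul (φ ψ : CEemb) {p : ℂ × ℂ} (h1 : p.1 ∈ ball (0 : ℂ) 1) (h2 : p.2 ∈ ball (0 : ℂ) 1) :
    F (φ * ψ) p = deriv (fn ψ) p.1 * deriv (fn ψ) p.2 * F φ ((fn ψ) p.1, (fn ψ) p.2) + F ψ p := by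
  simp only [F, deriv_fn_mul φ ψ h1, deriv_fn_mul φ ψ h2, fn_mul_eqOn φ ψ h1,
    fn_mul_eqOn φ ψ h2, Function.comp_apply]
  ring

theorem lintegral_F_comp_le (ψ : CEemb) {g : ℂ × ℂ → ℝ≥0∞} (hg : Measurable g) :
    ∫⁻ p, ‖deriv (fn ψ) p.1‖ₑ ^ 2 * ‖deriv (fn ψ) p.2‖ₑ ^ 2 * g ((fn ψ) p.1, (fn ψ) p.2) ∂(μD.prod μD)
      ≤ ∫⁻ p, g p ∂(μD.prod μD) := by
  have h1 := measurable_fn ψ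
  have h2 := measurable_deriv (fn ψ)
  rw [lintegral_prod _ (by fun_prop), lintegral_prod _ hg.aemeasurable]
  calc ∫⁻ z, ∫⁻ w, ‖deriv (fn ψ) z‖ₑ ^ 2 * ‖deriv (fn ψ) w‖ₑ ^ 2 * g ((fn ψ) z, (fn ψ) w) ∂μD ∂μD
      = ∫⁻ z, ‖deriv (fn ψ) z‖ₑ ^ 2 * ∫⁻ w, ‖deriv (fn ψ) w‖ₑ ^ 2 * g ((fn ψ) z, (fn ψ) w) ∂μD ∂μD := by
        refine lintegral_congr fun z => ?_
        rw [← lintegral_const_mul' _ _ (by simp)]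
        simp only [mul_assoc]
    _ ≤ ∫⁻ z, ‖deriv (fn ψ) z‖ₑ ^ 2 * ∫⁻ w, g ((fn ψ) z, w) ∂μD ∂μD := by
        refine lintegral_mono fun z => ?_
        refine mul_le_mul_right ?_ _
        exact (fn_lintegral_comp_le ψ) fun w => g ((fn ψ) z, w)
    _ ≤ _ := (fn_lintegral_comp_le ψ) fun z => ∫⁻ w, g (z, w) ∂μD

/-- The monoid of disk embeddings `φ` with `F_φ ∈ L²(𝔻 × 𝔻)`. -/
def CEHS : Submonoid CEemb where
  carrier := {φ | MemLp (F φ) 2 (μD.prod μD)}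
  one_mem' := by
    have : F 1 =ᵐ[μD.prod μD] (fun _ => 0 : ℂ × ℂ → ℂ) := by
      filter_upwards [ae_prod_mem_ball] with p hp
      have h1 : ∀ z ∈ ball (0 : ℂ) 1, (fn (1 : CEemb)) z = z := by
        intro z hz
        lift z to 𝔻 using by simpa using hz
        exact fn_coe 1 z
      have h2 : ∀ z ∈ ball (0 : ℂ) 1, deriv (fn (1 : CEemb)) z = 1 := by
        intro z hz
        have h : (fn (1 : CEemb)) =ᶠ[𝓝 z] id :=
          Set.EqOn.eventuallyEq_of_mem h1 (isOpen_ball.mem_nhds hz)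
        rw [h.deriv_eq, deriv_id]
      simp [F, h1 _ hp.1, h1 _ hp.2, h2 _ hp.1, h2 _ hp.2]
    exact (memLp_congr_ae this).2 (by simp)
  mul_mem' := by
    intro φ ψ hφ hψ
    have h : F (φ * ψ) =ᵐ[μD.prod μD]
        (fun p => deriv (fn ψ) p.1 * deriv (fn ψ) p.2 * F φ ((fn ψ) p.1, (fn ψ) p.2)) + F ψ := by
      filter_upwards [ae_prod_mem_ball] with p hp
      exact F_mul φ ψ hp.1 hp.2
    refine (memLp_congr_ae h).2 (MemLp.add ⟨?_, ?_⟩ hψ)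
    · have h1 := measurable_fn ψ
      have h2 := measurable_deriv (fn ψ)
      have h3 := measurable_F φ
      exact Measurable.aestronglyMeasurable (by fun_prop)
    · have hle : eLpNorm (fun p : ℂ × ℂ => deriv (fn ψ) p.1 * deriv (fn ψ) p.2 *
          F φ ((fn ψ) p.1, (fn ψ) p.2)) 2 (μD.prod μD) ≤ eLpNorm (F φ) 2 (μD.prod μD) := by
        rw [← ENNReal.pow_le_pow_left_iff two_ne_zero, eLpNorm_two_sq, eLpNorm_two_sq]
        simp only [enorm_mul, mul_pow]
        exact lintegral_F_comp_le ψ ((measurable_F φ).enorm.pow_const 2)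
      exact hle.trans_lt hφ.2

theorem F_J (φ : CEemb) (p : ℂ × ℂ) : F (conjJ φ) p = conj (F φ (conj p.1, conj p.2)) := by
  have h : ∀ z, deriv (fn (conjJ φ)) z = conj (deriv (fn φ) (conj z)) := fun z => by
    rw [fn_conjJ, deriv_conj_conj]
    rfl
  have h' : ∀ z, (fn (conjJ φ)) z = conj ((fn φ) (conj z)) := fun z => congrFun (fn_conjJ φ) z
  simp only [F, h, h', map_sub, map_div₀, map_mul, map_pow, map_one,
    Complex.conj_conj]

theorem measurePreserving_conj : MeasurePreserving (fun z : ℂ => conj z) μD μD := by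
  have h := (LinearIsometryEquiv.measurePreserving Complex.conjLIE).restrict_preimage
    (measurableSet_ball (x := (0 : ℂ)) (ε := 1))
  have h2 : (Complex.conjLIE : ℂ → ℂ) ⁻¹' ball 0 1 = ball 0 1 := by
    ext z; simp
  rw [h2] at h
  exact h.smul_measure _

theorem memLp_F_J (φ : CEHS) : MemLp (F (conjJ φ.1)) 2 (μD.prod μD) := by
  have h : MemLp (F φ.1) 2 (μD.prod μD) := φ.2
  have h2 := (h.comp_measurePreserving (measurePreserving_conj.prod measurePreserving_conj)).star
  refine h2.congr_norm (measurable_F _).aestronglyMeasurable (.of_forall fun p => ?_)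
  simp [F_J, Prod.map]

/-- The element `F_{𝒥 φ}` of `L²(𝔻 × 𝔻)`. -/
def FJ (φ : CEHS) : Lp ℂ 2 (μD.prod μD) := (memLp_F_J φ).toLp _

theorem memLp_mul_prod (f g : Lp ℂ 2 μD) :
    MemLp (fun p : ℂ × ℂ => f p.1 * g p.2) 2 (μD.prod μD) := by
  have hf := Lp.memLp f
  have hg := Lp.memLp g
  refine ⟨(hf.1.comp_fst).mul (hg.1.comp_snd), ?_⟩
  refine lt_of_not_ge fun htop => ?_
  have h2 : eLpNorm (fun p : ℂ × ℂ => f p.1 * g p.2) 2 (μD.prod μD) ^ 2 < ∞ := ?_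
  · rw [top_le_iff.1 htop] at h2
    simp at h2
  rw [eLpNorm_two_sq]
  simp only [enorm_mul, mul_pow]
  rw [lintegral_prod_mul (hf.1.enorm.pow_const 2) (hg.1.enorm.pow_const 2), ← eLpNorm_two_sq,
    ← eLpNorm_two_sq]
  exact ENNReal.mul_lt_top (ENNReal.pow_lt_top hf.2) (ENNReal.pow_lt_top hg.2)

theorem inner_mul_prod (f g f' g' : Lp ℂ 2 μD) :
    inner ℂ ((memLp_mul_prod f g).toLp _) ((memLp_mul_prod f' g').toLp _)
      = inner ℂ f f' * inner ℂ g g' := by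
  rw [L2.inner_def, L2.inner_def, L2.inner_def, ← integral_prod_mul]
  refine integral_congr_ae ?_
  filter_upwards [(memLp_mul_prod f g).coeFn_toLp, (memLp_mul_prod f' g').coeFn_toLp] with p h1 h2
  rw [h1, h2]
  simp only [RCLike.inner_apply, map_mul]
  ring

theorem exists_toL2 : ∃ W : HTensor A2 A2 →L[ℂ] Lp ℂ 2 (μD.prod μD), ∀ f g : A2,
    W (htmul f g) = (memLp_mul_prod (f : Lp ℂ 2 μD) g).toLp _ :=
  exists_htensor_lift (fun f g : A2 => (memLp_mul_prod (f : Lp ℂ 2 μD) g).toLp _)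
    fun f g f' g' => inner_mul_prod f g f' g'

/-- The isometric embedding `A²(𝔻) ⊗ A²(𝔻) → L²(𝔻 × 𝔻)`, `f ⊗ g ↦ f(z) g(w)`. -/
def toL2 : HTensor A2 A2 →L[ℂ] Lp ℂ 2 (μD.prod μD) := exists_toL2.choose

theorem toL2_htmul (f g : A2) :
    toL2 (htmul f g) = (memLp_mul_prod (f : Lp ℂ 2 μD) g).toLp _ := exists_toL2.choose_spec f g

/-- The functional `∂_φ(P) = ⟪F_{𝒥 φ}, P⟫ = ∫ F_φ(conj z, conj w) P(z, w)` on
`A²(𝔻) ⊗ A²(𝔻)`. -/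
def pairing (φ : CEHS) : HTensor A2 A2 →L[ℂ] ℂ := (innerSL ℂ (FJ φ)).comp toL2

theorem pairing_apply (φ : CEHS) (P : HTensor A2 A2) :
    pairing φ P = ∫ p : ℂ × ℂ, F φ (conj p.1, conj p.2) * toL2 P p ∂(μD.prod μD) := by
  rw [pairing, ContinuousLinearMap.comp_apply, innerSL_apply_apply, L2.inner_def]
  refine integral_congr_ae ?_
  filter_upwards [(memLp_F_J φ).coeFn_toLp] with p hp
  rw [FJ, hp, RCLike.inner_apply, F_J, Complex.conj_conj, mul_comm]

/-- `ρ(φ) = ρ_cl(φ) ∘ exp(∂_φ)` on `⨁ₚ A²(𝔻)^{⊗ p}`. -/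
def rhoTensor (φ : CEHS) : Module.End ℂ (TensorAlg A2) :=
  tensorAlgMap (rhoCl φ) ∘ₗ expContract (pairing φ)

/-! ### Möbius transformations -/

theorem one_sub_conj_mul_ne_zero (α z : 𝔻) : 1 - conj (α : ℂ) * z ≠ 0 := by
  intro h
  have h1 : ‖conj (α : ℂ) * z‖ < 1 := by
    rw [norm_mul, RCLike.norm_conj]
    nlinarith [α.norm_lt_one, z.norm_lt_one, norm_nonneg (α : ℂ), norm_nonneg (z : ℂ)]
  rw [← sub_eq_zero.1 h, norm_one] at h1
  exact lt_irrefl _ h1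

theorem norm_moebius_lt_one (u : Circle) (α z : 𝔻) :
    ‖(u : ℂ) * ((z - α) / (1 - conj (α : ℂ) * z))‖ < 1 := by
  rw [norm_mul, Circle.norm_coe, one_mul, norm_div,
    div_lt_one (norm_pos_iff.2 (one_sub_conj_mul_ne_zero α z)),
    ← sq_lt_sq₀ (norm_nonneg _) (norm_nonneg _), ← Complex.normSq_eq_norm_sq,
    ← Complex.normSq_eq_norm_sq]
  have h1 := α.normSq_lt_one
  have h2 := z.normSq_lt_one
  have h3 : 0 < (1 - Complex.normSq α) * (1 - Complex.normSq z) :=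
    mul_pos (by linarith) (by linarith)
  simp only [Complex.normSq_apply, Complex.sub_re, Complex.sub_im, Complex.mul_re, Complex.mul_im,
    Complex.conj_re, Complex.conj_im, Complex.one_re, Complex.one_im] at h3 ⊢
  nlinarith

/-- The Möbius transformation `z ↦ u (z - α) / (1 - conj α z)` with `|u| = 1`, `|α| < 1`. -/
def moebiusFun (u : Circle) (α : 𝔻) (z : 𝔻) : 𝔻 := .mk _ (norm_moebius_lt_one u α z)

theorem coe_moebiusFun (u : Circle) (α z : 𝔻) :
    (moebiusFun u α z : ℂ) = u * ((z - α) / (1 - conj (α : ℂ) * z)) := rfl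

theorem moebius_sub (u : Circle) (α z w : 𝔻) :
    (u : ℂ) * ((z - α) / (1 - conj (α : ℂ) * z)) - u * ((w - α) / (1 - conj (α : ℂ) * w))
      = u * (1 - conj (α : ℂ) * α) * (z - w) /
        ((1 - conj (α : ℂ) * z) * (1 - conj (α : ℂ) * w)) := by
  have h1 := one_sub_conj_mul_ne_zero α z
  have h2 := one_sub_conj_mul_ne_zero α w
  rw [← mul_sub, div_sub_div _ _ h1 h2, mul_assoc, mul_div_assoc]
  congr 2
  ring

theorem ext_moebius_eqOn (u : Circle) (α : 𝔻) : Set.EqOn (ext (moebiusFun u α))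
    (fun z => (u : ℂ) * ((z - α) / (1 - conj (α : ℂ) * z))) (ball 0 1) := by
  intro z hz
  lift z to 𝔻 using by simpa using hz
  rw [ext_coe, coe_moebiusFun]

theorem hasDerivAt_ext_moebius (u : Circle) (α z : 𝔻) :
    HasDerivAt (ext (moebiusFun u α))
      (u * (1 - conj (α : ℂ) * α) / (1 - conj (α : ℂ) * z) ^ 2) z := by
  have hz : (z : ℂ) ∈ ball (0 : ℂ) 1 := by simpa using z.norm_lt_one
  have h1 := one_sub_conj_mul_ne_zero α z
  have h2 : HasDerivAt (fun w : ℂ => w - α) 1 z := (hasDerivAt_id _).sub_const _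
  have h3 : HasDerivAt (fun w : ℂ => 1 - conj (α : ℂ) * w) (-(conj (α : ℂ) * 1)) z :=
    ((hasDerivAt_id _).const_mul _).const_sub _
  refine (((h2.div h3 h1).const_mul (u : ℂ)).congr_of_eventuallyEq
    ((ext_moebius_eqOn u α).eventuallyEq_of_mem (isOpen_ball.mem_nhds hz))).congr_deriv ?_
  rw [mul_div_assoc]
  congr 2
  ring

theorem moebius_mem_CEemb (u : Circle) (α : 𝔻) : (moebiusFun u α : Function.End 𝔻) ∈ CEemb := by
  refine ⟨fun z hz => ?_, fun z w h => ?_⟩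
  · lift z to 𝔻 using by simpa using hz
    exact (hasDerivAt_ext_moebius u α z).differentiableAt.differentiableWithinAt
  · have h0 := moebius_sub u α z w
    rw [← coe_moebiusFun, ← coe_moebiusFun, h, sub_self, eq_comm, div_eq_zero_iff] at h0
    have h1 := one_sub_conj_mul_ne_zero α z
    have h2 := one_sub_conj_mul_ne_zero α w
    have h3 := one_sub_conj_mul_ne_zero α α
    simpa [h1, h2, h3, sub_eq_zero] using h0

theorem moebius_mem_CEHS (u : Circle) (α : 𝔻) :
    (⟨moebiusFun u α, moebius_mem_CEemb u α⟩ : CEemb) ∈ CEHS := by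
  have h : F ⟨moebiusFun u α, moebius_mem_CEemb u α⟩ =ᵐ[μD.prod μD] fun _ => (0 : ℂ) := by
    filter_upwards [ae_prod_mem_ball] with p hp
    obtain ⟨z, w⟩ := p
    obtain ⟨hz, hw⟩ := hp
    lift z to 𝔻 using by simpa using hz
    lift w to 𝔻 using by simpa using hw
    have h1 := one_sub_conj_mul_ne_zero α z
    have h2 := one_sub_conj_mul_ne_zero α w
    have h3 := one_sub_conj_mul_ne_zero α α
    have h4 := u.coe_ne_zero
    simp only [F, fn, (hasDerivAt_ext_moebius u α z).deriv, (hasDerivAt_ext_moebius u α w).deriv,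
      ext_coe, coe_moebiusFun, moebius_sub]
    by_cases h : (z : ℂ) - w = 0
    · simp [h]
    · field_simp
      ring
  exact (memLp_congr_ae h).2 (by simp)

/-- The Möbius transformation as an element of the monoid. -/
def moebius (u : Circle) (α : 𝔻) : CEHS :=
  ⟨⟨moebiusFun u α, moebius_mem_CEemb u α⟩, moebius_mem_CEHS u α⟩

theorem CEHS_ext {φ ψ : CEHS} (h : ∀ z : 𝔻, (φ.1.1 z : 𝔻) = (ψ.1.1 z : 𝔻)) : φ = ψ :=
  Subtype.ext (Subtype.ext (funext h))

theorem moebius_mul_aux {u v v' α α' β β' z s s' : ℂ} (hv : v' * v = 1) (hs : s = v' * α * β')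
    (hs' : s' = v * α' * β) (h1 : 1 + s ≠ 0) (h2 : 1 + s' ≠ 0)
    (hd1 : 1 - α' * (v * ((z - β) / (1 - β' * z))) ≠ 0) (hd2 : 1 - β' * z ≠ 0) :
    u * ((v * ((z - β) / (1 - β' * z)) - α) / (1 - α' * (v * ((z - β) / (1 - β' * z)))))
      = u * v * ((1 + s) / (1 + s')) *
        ((z - (v' * α + β) / (1 + s)) / (1 - (v * α' + β') / (1 + s') * z)) := by
  have e1 : v * ((z - β) / (1 - β' * z)) - α = v * ((1 + s) * z - (v' * α + β)) / (1 - β' * z) := by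
    rw [eq_div_iff hd2, sub_mul, mul_assoc, div_mul_cancel₀ _ hd2, hs]
    linear_combination (α - α * β' * z) * hv
  have e2 : 1 - α' * (v * ((z - β) / (1 - β' * z)))
      = ((1 + s') - (v * α' + β') * z) / (1 - β' * z) := by
    rw [eq_div_iff hd2, sub_mul, mul_assoc, mul_assoc, div_mul_cancel₀ _ hd2, hs']
    ring
  have e3 : z - (v' * α + β) / (1 + s) = ((1 + s) * z - (v' * α + β)) / (1 + s) := by
    rw [eq_div_iff h1, sub_mul, div_mul_cancel₀ _ h1]; ring
  have e4 : 1 - (v * α' + β') / (1 + s') * z = ((1 + s') - (v * α' + β') * z) / (1 + s') := by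
    rw [eq_div_iff h2, sub_mul, mul_right_comm, div_mul_cancel₀ _ h2]; ring
  have h5 : (1 + s') - (v * α' + β') * z ≠ 0 := by
    intro h; rw [e2, h, zero_div] at hd1; exact hd1 rfl
  rw [e1, e2, e3, e4, div_div_div_cancel_right₀ hd2]
  generalize (1 + s') - (v * α' + β') * z = D at *
  generalize (1 + s) * z - (v' * α + β) = N at *
  field_simp

theorem exists_moebius_mul (u v : Circle) (α β : 𝔻) :
    ∃ (w : Circle) (γ : 𝔻), moebius u α * moebius v β = moebius w γ := by
  set s : ℂ := conj (v : ℂ) * α * conj (β : ℂ) with hs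
  have hv : conj (v : ℂ) * v = 1 := by
    rw [mul_comm, Complex.mul_conj, Complex.normSq_eq_norm_sq, Circle.norm_coe]; simp
  have hs1 : 1 + s ≠ 0 := by
    have := one_sub_conj_mul_ne_zero (-β) (v⁻¹ • α)
    intro h
    apply this
    rw [UnitDisc.coe_neg, UnitDisc.coe_circle_smul, Circle.coe_inv_eq_conj, map_neg, ← h, hs]
    ring
  have hs2 : 1 + conj s ≠ 0 := by
    intro h
    apply hs1
    have := congrArg conj h
    simpa using this
  have hw : ‖(u : ℂ) * v * ((1 + s) / (1 + conj s))‖ = 1 := by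
    have : ‖1 + conj s‖ = ‖1 + s‖ := by
      rw [← RCLike.norm_conj (1 + s), map_add, map_one]
    rw [norm_mul, norm_mul, Circle.norm_coe, Circle.norm_coe, norm_div, this,
      div_self (norm_ne_zero_iff.2 hs1)]
    norm_num
  obtain ⟨w, hwc⟩ : ∃ w : Circle, (w : ℂ) = (u : ℂ) * v * ((1 + s) / (1 + conj s)) :=
    ⟨⟨_, mem_sphere_zero_iff_norm.2 hw⟩, rfl⟩
  refine ⟨w, moebiusFun 1 (-β) (v⁻¹ • α), CEHS_ext fun z => ?_⟩
  apply UnitDisc.coe_injective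
  change (moebiusFun u α (moebiusFun v β z) : ℂ) =
    (moebiusFun w (moebiusFun 1 (-β) (v⁻¹ • α)) z : ℂ)
  have hγ : (moebiusFun 1 (-β) (v⁻¹ • α) : ℂ) = (conj (v : ℂ) * α + β) / (1 + s) := by
    rw [coe_moebiusFun, UnitDisc.coe_neg, UnitDisc.coe_circle_smul, Circle.coe_inv_eq_conj,
      map_neg, hs]
    simp only [Circle.coe_one, one_mul]
    congr 1 <;> ring
  have hγ' : conj (moebiusFun 1 (-β) (v⁻¹ • α) : ℂ)
      = (v * conj (α : ℂ) + conj (β : ℂ)) / (1 + conj s) := by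
    rw [hγ]; simp
  have hd1 := one_sub_conj_mul_ne_zero α (moebiusFun v β z)
  have hd2 := one_sub_conj_mul_ne_zero β z
  have hc : conj s = v * conj (α : ℂ) * β := by simp [hs]
  rw [coe_moebiusFun v β z] at hd1
  refine Eq.trans (b := (u : ℂ) * ((v * ((z - β) / (1 - conj (β : ℂ) * z)) - α) /
    (1 - conj (α : ℂ) * (v * ((z - β) / (1 - conj (β : ℂ) * z)))))) ?_ ?_
  · rw [coe_moebiusFun, coe_moebiusFun]
  refine Eq.trans (b := (u : ℂ) * v * ((1 + s) / (1 + conj s)) *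
    ((z - (conj (v : ℂ) * α + β) / (1 + s)) /
      (1 - (v * conj (α : ℂ) + conj (β : ℂ)) / (1 + conj s) * z))) ?_ ?_
  · exact moebius_mul_aux hv hs hc hs1 hs2 hd1 hd2
  · rw [← hγ', ← hγ, ← hwc]
    exact (coe_moebiusFun _ _ z).symm

/-- `PSU(1,1)`: the group of all Möbius transformations of the disk. -/
def PSU11 : Submonoid CEHS where
  carrier := Set.range fun p : Circle × 𝔻 => moebius p.1 p.2
  one_mem' := ⟨(1, 0), CEHS_ext fun z => UnitDisc.coe_injective (by
    change (moebiusFun 1 0 z : ℂ) = z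
    simp [coe_moebiusFun])⟩
  mul_mem' := by
    rintro _ _ ⟨p, rfl⟩ ⟨q, rfl⟩
    obtain ⟨w, γ, h⟩ := exists_moebius_mul p.1 q.1 p.2 q.2
    exact ⟨(w, γ), h.symm⟩

/-- The usual topology of `PSU(1,1)`, for which the bijection `(u, α) ↦ moebius u α` from
`{|u| = 1} × 𝔻` is a homeomorphism. -/
instance : TopologicalSpace PSU11 :=
  TopologicalSpace.coinduced (fun p : Circle × 𝔻 => ⟨moebius p.1 p.2, p, rfl⟩) inferInstance

end Bergman

end BergmanCE

end

open BergmanCE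

noncomputable section

open scoped TensorProduct ComplexConjugate ENNReal Topology Complex.UnitDisc
open UniformSpace (Completion)
open MeasureTheory Metric Filter Complex

namespace BergmanCE

/-! ### Powers of vectors, polarization, and contraction of powers -/

section TensorPowers

variable {H K : Type} [NormedAddCommGroup H] [InnerProductSpace ℂ H]
  [NormedAddCommGroup K] [InnerProductSpace ℂ K]

/-! Formally, on the exponential vector $e^a=\sum_n a^{\otimes n}/n!$ the operator
$A^{\otimes}\circ\exp(\partial_\beta)$ acts by $e^a\mapsto e^{\beta(a\otimes a)/2}\,e^{Aa}$. Under
composition the scalar factors multiply. Hence the operators of $(A',\beta')$ and $(A,\beta)$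
compose to that of $(A'A,\beta'')$ as soon as $\beta''(a\otimes a)=\beta'(Aa\otimes
Aa)+\beta(a\otimes a)$ for all $a$. Degree by degree this is a statement about finite sums:
`gaussOp_divPow` gives the action on $a^{\otimes n}/n!$, and `gaussOp_comp_divPow` is the binomial
theorem. Polarization shows that powers span a dense subspace of $\mathrm{Sym}^p$. The operators do
not raise degrees and are continuous between homogeneous components, so identities checked on powers
extend to all symmetric tensors (`DegBounded.eqOn`), and so does the invariance of the symmetric
tensors (`DegBounded.mem_range`).

It remains to verify the cocycle identity for $\beta=\partial_\phi$, $A=\rho_{\mathrm{cl}}(\psi)$.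
The chain rule gives $F_{\phi\psi}(z,w)=\psi'(z)\psi'(w)F_\phi(\psi(z),\psi(w))+F_\psi(z,w)$. The
first term is $(T_\psi\otimes T_\psi)F_\phi$, so pairing it with $f\otimes g$ moves $T_\psi^*$ onto
$f$ and $g$ (`integral_conj_F_comp`, `pairing_mul`). This is done one variable at a time: almost
every slice $F_\phi(\cdot,w)$ is square-integrable and has only a removable singularity, hence
represents an element of $A^2(\mathbb D)$.

For Möbius maps $F_\phi$ vanishes, so $\rho$ reduces to the tensor powers of $\rho_{\mathrm{cl}}$.
There $\rho_{\mathrm{cl}}(g)$ is a contraction with contractive inverse, hence isometric. Weak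
continuity follows from explicit point evaluations and the density of the span of reproducing
kernels. For isometries it implies strong continuity, which passes to tensor powers and finite sums.
-/

theorem htmul_add (a : H) (x y : K) : htmul a (x + y) = htmul a x + htmul a y := by
  simp [htmul, TensorProduct.tmul_add, Completion.coe_add]

theorem add_htmul (a b : H) (x : K) : htmul (a + b) x = htmul a x + htmul b x := by
  simp [htmul, TensorProduct.add_tmul, Completion.coe_add]

theorem htmul_smul (c : ℂ) (a : H) (x : K) : htmul a (c • x) = c • htmul a x := by
  simp [htmul]

theorem smul_htmul (c : ℂ) (a : H) (x : K) : htmul (c • a) x = c • htmul a x := by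
  simp [htmul, ← TensorProduct.smul_tmul']

theorem continuous_htmul : Continuous fun p : H × K => htmul p.1 p.2 :=
  (Completion.continuous_coe _).comp TensorProduct.continuous_tmul

variable [CompleteSpace H]

theorem tprod_succ {n : ℕ} (a : Fin (n + 1) → H) :
    tprod a = (htmul (a 0) (tprod (Fin.tail a)) : HTensor H (TPow H n)) := rfl

theorem continuous_tprod : ∀ n : ℕ, Continuous (tprod : (Fin n → H) → TPow H n)
  | 0 => continuous_const
  | n + 1 => by
    have h : Continuous fun a : Fin (n + 1) → H => (a 0, (tprod (Fin.tail a) : TPow H n)) :=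
      (continuous_apply 0).prodMk ((continuous_tprod n).comp
        (continuous_pi fun i => continuous_apply i.succ))
    exact continuous_htmul.comp h

theorem tprod_sum_smul {ι : Type*} [Fintype ι] : ∀ (n : ℕ) (c : Fin n → ι → ℂ)
    (b : Fin n → ι → H),
    (tprod (fun i => ∑ j, c i j • b i j) : TPow H n) =
      ∑ f : Fin n → ι, (∏ i, c i (f i)) • tprod fun i => b i (f i)
  | 0, c, b => by
    simp only [Finset.univ_eq_empty, Finset.prod_empty, one_smul, Finset.univ_unique,
      Finset.sum_singleton]
    rfl
  | n + 1, c, b => by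
    have ih := tprod_sum_smul n (fun i => c i.succ) (fun i => b i.succ)
    have hl : ∀ (s : Finset ι) (x : TPow H n), (htmul (∑ j ∈ s, c 0 j • b 0 j) x : HTensor H (TPow H n))
        = ∑ j ∈ s, c 0 j • htmul (b 0 j) x := by
      intro s x
      classical
      induction s using Finset.induction_on with
      | empty => simp [htmul, Completion.coe_zero]
      | insert j s hj ih => rw [Finset.sum_insert hj, Finset.sum_insert hj, add_htmul, ih,
          smul_htmul]
    have hr : ∀ (s : Finset (Fin n → ι)) (a : H) (y : (Fin n → ι) → ℂ) (z : (Fin n → ι) → TPow H n),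
        (htmul a (∑ f ∈ s, y f • z f) : HTensor H (TPow H n)) = ∑ f ∈ s, y f • htmul a (z f) := by
      intro s a y z
      classical
      induction s using Finset.induction_on with
      | empty => simp [htmul, Completion.coe_zero]
      | insert j s hj ih => rw [Finset.sum_insert hj, Finset.sum_insert hj, htmul_add, ih,
          htmul_smul]
    rw [tprod_succ, hl]
    refine Eq.trans ?_ ((Fin.consEquiv fun _ => ι).sum_comp
      (fun f : Fin (n + 1) → ι => (∏ i, c i (f i)) • (tprod fun i => b i (f i) : TPow H (n + 1))))
    rw [Fintype.sum_prod_type]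
    refine Finset.sum_congr rfl fun j _ => ?_
    have : (tprod (Fin.tail fun i => ∑ j, c i j • b i j) : TPow H n)
        = ∑ f : Fin n → ι, (∏ i, c i.succ (f i)) • tprod fun i => b i.succ (f i) := ih
    rw [this, hr, Finset.smul_sum]
    refine Finset.sum_congr rfl fun f _ => ?_
    rw [smul_smul, Fin.prod_univ_succ, tprod_succ]
    rfl

/-- The power `a ⊗ ⋯ ⊗ a`. -/
def tpow (n : ℕ) (a : H) : TPow H n := tprod fun _ => a

theorem tensorMap_tpow (A : H →L[ℂ] H) (n : ℕ) (a : H) :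
    tensorMap A n (tpow n a) = tpow n (A a) := tensorMap_tprod A _

theorem tpow_mem_symPow (n : ℕ) (a : H) : tpow n a ∈ SymPow H n := by
  refine ⟨tpow n a, ?_⟩
  change symmetrizer H n (tprod fun _ => a) = _
  rw [symmetrizer_tprod]
  change ((n.factorial : ℂ)⁻¹) • ∑ _ : Equiv.Perm (Fin n), tpow n a = tpow n a
  rw [Finset.sum_const, Finset.card_univ, Fintype.card_perm, Fintype.card_fin,
    ← Nat.cast_smul_eq_nsmul ℂ, smul_smul,
    inv_mul_cancel₀ (Nat.cast_ne_zero.2 n.factorial_ne_zero), one_smul]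

/-- The sum factors over the points `i` into $\sum_{e=\pm1}e^{1+|f^{-1}(i)|}$. If `f` is bijective
every factor is 2. Otherwise some `i` is missed and its factor is $1-1=0$. -/
theorem sum_sign_prod (n : ℕ) (f : Fin n → Fin n) :
    ∑ ε : Fin n → Bool, (∏ i, (if ε i then (1 : ℂ) else -1)) * ∏ i, (if ε (f i) then (1 : ℂ) else -1)
      = if Function.Bijective f then 2 ^ n else 0 := by
  classical
  have h1 : ∀ ε : Fin n → Bool, (∏ i, (if ε i then (1 : ℂ) else -1)) *
      ∏ i, (if ε (f i) then (1 : ℂ) else -1)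
      = ∏ i, (if ε i then (1 : ℂ) else -1) ^ (1 + (Finset.univ.filter fun j => f j = i).card) := by
    intro ε
    simp only [pow_add, pow_one, Finset.prod_mul_distrib]
    congr 1
    rw [← Finset.prod_fiberwise Finset.univ f]
    refine Finset.prod_congr rfl fun i _ => ?_
    rw [Finset.prod_congr rfl (g := fun _ => (if ε i then (1 : ℂ) else -1)), Finset.prod_const]
    intro j hj
    rw [(Finset.mem_filter.1 hj).2]
  rw [Finset.sum_congr rfl fun ε _ => h1 ε, ← Fintype.prod_sum (fun (i : Fin n) (e : Bool) =>
    (if e then (1 : ℂ) else -1) ^ (1 + (Finset.univ.filter fun j => f j = i).card))]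
  split_ifs with hf
  · rw [Finset.prod_congr rfl (g := fun _ => (2 : ℂ))]
    · simp
    · intro i _
      obtain ⟨j, rfl⟩ := hf.2 i
      have : (Finset.univ.filter fun k => f k = f j) = {j} := by
        ext k; simp [hf.1.eq_iff]
      rw [this]
      norm_num
  · have hs : ¬ Function.Surjective f := fun h => hf (Finite.surjective_iff_bijective.1 h)
    rw [Function.Surjective] at hs
    push Not at hs
    obtain ⟨i, hi⟩ := hs
    refine Finset.prod_eq_zero (Finset.mem_univ i) ?_
    have : (Finset.univ.filter fun k => f k = i) = ∅ := by
      ext k; simp [hi k]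
    rw [this]
    norm_num

/-- Polarization: symmetrized pure tensors are combinations of powers. -/
theorem symmetrizer_tprod_eq_sum_tpow {n : ℕ} (a : Fin n → H) :
    symmetrizer H n (tprod a) = ((n.factorial : ℂ)⁻¹) • ((2 : ℂ) ^ n)⁻¹ •
      ∑ ε : Fin n → Bool, (∏ i, (if ε i then (1 : ℂ) else -1)) •
        tpow n (∑ i, (if ε i then (1 : ℂ) else -1) • a i) := by
  classical
  rw [symmetrizer_tprod]
  congr 1
  have h1 : ∀ ε : Fin n → Bool, tpow n (∑ i, (if ε i then (1 : ℂ) else -1) • a i)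
      = ∑ f : Fin n → Fin n, (∏ i, (if ε (f i) then (1 : ℂ) else -1)) •
        (tprod (a ∘ f) : TPow H n) := fun ε =>
    tprod_sum_smul n (fun _ j => if ε j then (1 : ℂ) else -1) (fun _ => a)
  simp only [h1, Finset.smul_sum, smul_smul]
  -- With the sum over signs innermost, `sum_sign_prod` kills every non-bijective `f`; the others
  -- are the permutations, each with weight $2^n$.
  rw [Finset.sum_comm]
  have h2 : ∀ f : Fin n → Fin n, ∑ ε : Fin n → Bool, ((((2 : ℂ) ^ n)⁻¹ *
      ((∏ i, (if ε i then (1 : ℂ) else -1)) * ∏ i, (if ε (f i) then (1 : ℂ) else -1)))) •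
        (tprod (a ∘ f) : TPow H n) = if Function.Bijective f then tprod (a ∘ f) else 0 := by
    intro f
    rw [← Finset.sum_smul, ← Finset.mul_sum, sum_sign_prod]
    split_ifs <;> simp
  rw [Finset.sum_congr rfl fun f _ => h2 f, ← Finset.sum_filter]
  refine Finset.sum_bij' (fun σ _ => ⇑σ)
    (fun f hf => Equiv.ofBijective f (Finset.mem_filter.1 hf).2) ?_ ?_ ?_ ?_ ?_
  · intro σ _; exact Finset.mem_filter.2 ⟨Finset.mem_univ _, σ.bijective⟩
  · simp
  · intro σ _; ext; rfl
  · intro f hf; rfl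
  · intro σ _; rfl

theorem isClosed_symPow (p : ℕ) : IsClosed (SymPow H p : Set (TPow H p)) :=
  ContinuousLinearMap.IsIdempotentElem.isClosed_range (symmetrizer_idem p)

/-- The powers `a ⊗ ⋯ ⊗ a` span a dense subspace of the symmetric tensors. -/
theorem symPow_eq_closure_span_tpow (p : ℕ) :
    SymPow H p = (Submodule.span ℂ (Set.range (tpow p : H → TPow H p))).topologicalClosure := by
  refine le_antisymm ?_ (Submodule.topologicalClosure_minimal _
    (Submodule.span_le.2 (by rintro _ ⟨a, rfl⟩; exact tpow_mem_symPow p a)) (isClosed_symPow p))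
  rintro _ ⟨x, rfl⟩
  have hx : x ∈ (Submodule.span ℂ (Set.range (tprod : (Fin p → H) → TPow H p))).topologicalClosure :=
    dense_tprod (H := H) p ▸ Submodule.mem_top
  -- The symmetrizer is continuous and pure tensors are total, so it suffices to treat symmetrized
  -- pure tensors, where polarization applies.
  refine map_mem_closure (f := symmetrizer H p) (symmetrizer H p).continuous hx fun y hy => ?_
  induction hy using Submodule.span_induction with
  | mem y hy =>
    obtain ⟨a, rfl⟩ := hy
    rw [symmetrizer_tprod_eq_sum_tpow]
    exact Submodule.smul_mem _ _ (Submodule.smul_mem _ _ (Submodule.sum_mem _ fun ε _ =>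
      Submodule.smul_mem _ _ (Submodule.subset_span ⟨_, rfl⟩)))
  | zero => simp
  | add y z _ _ hy hz => rw [map_add]; exact Submodule.add_mem _ hy hz
  | smul c y _ hy => rw [map_smul]; exact Submodule.smul_mem _ _ hy

/-- A closed subspace containing all powers contains all symmetric tensors. -/
theorem symPow_le {p : ℕ} {S : Submodule ℂ (TPow H p)} (hS : IsClosed (S : Set (TPow H p)))
    (h : ∀ a, tpow p a ∈ S) : SymPow H p ≤ S := by
  rw [symPow_eq_closure_span_tpow]
  refine Submodule.topologicalClosure_minimal _ (Submodule.span_le.2 ?_) hS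
  rintro _ ⟨a, rfl⟩
  exact h a

/-- Each of the $(n+2)(n+1)/2$ pairs of positions contributes the same term. The 2 is attached to
`β` so that $(n+2)(n+1)$ can cancel against the factorials of divided powers. -/
theorem contract_tpow (β : HTensor H H →L[ℂ] ℂ) (n : ℕ) (a : H) :
    contract β n (tpow (n + 2) a) =
      (((n + 2) * (n + 1) : ℂ) * (β (htmul a a) / 2)) • tpow n a := by
  have h : ∀ i : Fin (n + 2), ∑ j : Fin (n + 1), (if i < i.succAbove j then
      β (htmul a a) • (tpow n a : TPow H n) else 0)
      = ((n + 1 : ℂ) - i) • β (htmul a a) • tpow n a := by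
    intro i
    rw [← Finset.sum_filter, Finset.sum_const, ← Nat.cast_smul_eq_nsmul ℂ]
    congr 1
    -- The map `i.succAbove` identifies the admissible `j` with the positions beyond `i`.
    have : (Finset.univ.filter fun j : Fin (n + 1) => i < i.succAbove j).card = n + 1 - i := by
      have h2 : (Finset.univ.filter fun j : Fin (n + 1) => i < i.succAbove j).map i.succAboveEmb
          = Finset.Ioi i := by
        ext k
        simp only [Finset.mem_map, Finset.mem_filter, Finset.mem_univ, true_and,
          Fin.succAboveEmb_apply, Finset.mem_Ioi]
        constructor
        · rintro ⟨j, hj, rfl⟩; exact hj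
        · intro hk
          obtain ⟨j, rfl⟩ := Fin.exists_succAbove_eq hk.ne'
          exact ⟨j, hk, rfl⟩
      rw [← Finset.card_map, h2, Fin.card_Ioi]
      omega
    rw [this, Nat.cast_sub (by omega)]
    push_cast
    ring
  change contract β n (tprod fun _ => a) = _
  rw [contract_tprod]
  refine (Finset.sum_congr rfl fun i _ => h i).trans ?_
  rw [← Finset.sum_smul, smul_smul]
  congr 1
  have h3 : ∑ i : Fin (n + 2), ((n + 1 : ℂ) - (i : ℕ)) = (n + 2) * (n + 1) / 2 := by
    rw [Finset.sum_sub_distrib, Finset.sum_const, Fin.sum_univ_eq_sum_range (fun i => (i : ℂ)),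
      ← Nat.cast_sum, Finset.card_univ, Fintype.card_fin, nsmul_eq_mul]
    have h4 := Finset.sum_range_id_mul_two (n + 2)
    have h5 : ((∑ i ∈ Finset.range (n + 2), i : ℕ) : ℂ) * 2 = (n + 2) * (n + 1) := by
      have h6 := congrArg (Nat.cast : ℕ → ℂ) h4
      rw [show n + 2 - 1 = n + 1 from rfl] at h6
      push_cast at h6 ⊢
      linear_combination h6
    push_cast at h5 ⊢
    linear_combination (-1 / 2 : ℂ) * h5
  rw [h3]
  ring

end TensorPowers

/-! ### Action of the Gaussian operators on divided powers -/

section GaussOp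

variable {H : Type} [NormedAddCommGroup H] [InnerProductSpace ℂ H] [CompleteSpace H]

/-- The divided power `(a ⊗ ⋯ ⊗ a) / n!` in the algebraic direct sum of the tensor powers. -/
def divPow (n : ℕ) (a : H) : TensorAlg H :=
  ((n.factorial : ℂ)⁻¹) • DirectSum.lof ℂ ℕ (fun p => TPow H p) n (tpow n a)

/-- The divided power of degree `n - 2 m`, zero if this is negative. -/
def lowDivPow (n m : ℕ) (a : H) : TensorAlg H := if 2 * m ≤ n then divPow (n - 2 * m) a else 0

theorem lowDivPow_zero (n : ℕ) (a : H) : lowDivPow n 0 a = divPow n a := by simp [lowDivPow]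

/-- On divided powers the contraction is a degree shift times a scalar independent of the degree.
This makes its exponential computable. -/
theorem contractAlg_divPow_add_two (β : HTensor H H →L[ℂ] ℂ) (n : ℕ) (a : H) :
    contractAlg β (divPow (n + 2) a) = (β (htmul a a) / 2) • divPow n a := by
  have h : contractAlg β (DirectSum.lof ℂ ℕ (fun p => TPow H p) (n + 2) (tpow (n + 2) a))
      = DirectSum.lof ℂ ℕ (fun p => TPow H p) n (contract β n (tpow (n + 2) a)) := by
    rw [contractAlg, DirectSum.toModule_lof]
    rfl
  rw [divPow, map_smul, h, contract_tpow, map_smul, divPow, smul_smul, smul_smul]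
  congr 1
  have h1 : (n.factorial : ℂ) ≠ 0 := Nat.cast_ne_zero.2 n.factorial_ne_zero
  have h2 : (n + 1 : ℂ) ≠ 0 := by exact_mod_cast n.succ_ne_zero
  have h3 : (n + 2 : ℂ) ≠ 0 := by exact_mod_cast (n + 1).succ_ne_zero
  rw [Nat.factorial_succ, Nat.factorial_succ]
  push_cast
  rw [show (n : ℂ) + 1 + 1 = n + 2 by ring]
  field_simp

theorem contractAlg_lowDivPow (β : HTensor H H →L[ℂ] ℂ) (n m : ℕ) (a : H) :
    contractAlg β (lowDivPow n m a) = (β (htmul a a) / 2) • lowDivPow n (m + 1) a := by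
  unfold lowDivPow
  by_cases h : 2 * m ≤ n
  · rw [if_pos h]
    obtain ⟨k, rfl⟩ := Nat.exists_eq_add_of_le h
    rw [Nat.add_sub_cancel_left]
    -- With `n = 2 * m + k`, the contraction is zero by definition in degrees `k = 0, 1`, exactly
    -- where the cutoff in `lowDivPow` sets in.
    match k with
    | 0 =>
      rw [if_neg (by omega), smul_zero, divPow, map_smul, contractAlg, DirectSum.toModule_lof]
      exact smul_zero _
    | 1 =>
      rw [if_neg (by omega), smul_zero, divPow, map_smul, contractAlg, DirectSum.toModule_lof]
      exact smul_zero _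
    | k + 2 =>
      rw [if_pos (by omega), contractAlg_divPow_add_two,
        show 2 * m + (k + 2) - 2 * (m + 1) = k by omega]
  · rw [if_neg h, if_neg (by omega), map_zero, smul_zero]

theorem contractAlg_pow_divPow (β : HTensor H H →L[ℂ] ℂ) (n m : ℕ) (a : H) :
    (contractAlg β ^ m) (divPow n a) = (β (htmul a a) / 2) ^ m • lowDivPow n m a := by
  induction m with
  | zero => simp [lowDivPow_zero]
  | succ m ih =>
    rw [pow_succ', Module.End.mul_apply, ih, map_smul, contractAlg_lowDivPow, smul_smul, pow_succ]

theorem lowDivPow_eq_zero {n m : ℕ} (h : n < m) (a : H) : lowDivPow n m a = 0 :=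
  if_neg (by omega)

theorem expContract_lof (β : HTensor H H →L[ℂ] ℂ) (p : ℕ) (x : TPow H p) :
    expContract β (DirectSum.lof ℂ ℕ (fun p => TPow H p) p x) =
      ∑ m ∈ Finset.range (p + 1), ((m.factorial : ℂ)⁻¹) •
        (contractAlg β ^ m) (DirectSum.lof ℂ ℕ (fun p => TPow H p) p x) := by
  rw [expContract, DirectSum.toModule_lof]
  simp

theorem tensorAlgMap_divPow (A : H →L[ℂ] H) (n : ℕ) (a : H) :
    tensorAlgMap A (divPow n a) = divPow n (A a) := by
  rw [divPow, map_smul, tensorAlgMap, DirectSum.lmap_lof]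
  change _ • DirectSum.lof ℂ ℕ (fun p => TPow H p) n (tensorMap A n (tpow n a)) = _
  rw [tensorMap_tpow, divPow]

theorem tensorAlgMap_lowDivPow (A : H →L[ℂ] H) (n m : ℕ) (a : H) :
    tensorAlgMap A (lowDivPow n m a) = lowDivPow n m (A a) := by
  unfold lowDivPow
  split_ifs
  · exact tensorAlgMap_divPow A _ a
  · exact map_zero _

/-- The operator `A^{⊗} ∘ exp(∂_β)` on `⨁ₚ H^{⊗ p}`. -/
def gaussOp (A : H →L[ℂ] H) (β : HTensor H H →L[ℂ] ℂ) : Module.End ℂ (TensorAlg H) :=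
  tensorAlgMap A ∘ₗ expContract β

/-- This is the degree-`n` part of $e^{ta}\mapsto e^{t^2\beta(a\otimes a)/2}e^{tAa}$ at $t=1$. Any
cutoff `N` beyond `n` gives the same sum because the extra terms vanish, so that operators applied
in succession can share one index range. -/
theorem gaussOp_divPow (A : H →L[ℂ] H) (β : HTensor H H →L[ℂ] ℂ) {n N : ℕ} (hN : n < N) (a : H) :
    gaussOp A β (divPow n a) = ∑ m ∈ Finset.range N,
      ((m.factorial : ℂ)⁻¹ * (β (htmul a a) / 2) ^ m) • lowDivPow n m (A a) := by
  have h1 : expContract β (divPow n a) = ∑ m ∈ Finset.range (n + 1),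
      ((m.factorial : ℂ)⁻¹ * (β (htmul a a) / 2) ^ m) • lowDivPow n m a := by
    rw [divPow, map_smul, expContract_lof, Finset.smul_sum]
    refine Finset.sum_congr rfl fun m _ => ?_
    rw [smul_comm, ← map_smul, mul_smul, ← contractAlg_pow_divPow]
    rfl
  rw [gaussOp, LinearMap.comp_apply, h1, map_sum]
  simp only [map_smul, tensorAlgMap_lowDivPow]
  refine Finset.sum_subset (Finset.range_subset_range.2 hN) fun m _ hm => ?_
  rw [lowDivPow_eq_zero (by simpa using hm), smul_zero]

theorem gaussOp_lowDivPow (A : H →L[ℂ] H) (β : HTensor H H →L[ℂ] ℂ) {n N : ℕ} (hN : n < N)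
    (m : ℕ) (a : H) :
    gaussOp A β (lowDivPow n m a) = ∑ k ∈ Finset.range N,
      ((k.factorial : ℂ)⁻¹ * (β (htmul a a) / 2) ^ k) • lowDivPow n (m + k) (A a) := by
  by_cases h : 2 * m ≤ n
  · rw [lowDivPow, if_pos h, gaussOp_divPow A β (N := N) (by omega)]
    refine Finset.sum_congr rfl fun k _ => ?_
    congr 1
    unfold lowDivPow
    by_cases h' : 2 * k ≤ n - 2 * m
    · rw [if_pos h', if_pos (by omega), show n - 2 * m - 2 * k = n - 2 * (m + k) by omega]
    · rw [if_neg h', if_neg (by omega)]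
  · rw [lowDivPow, if_neg h, map_zero, Finset.sum_eq_zero]
    intro k _
    rw [lowDivPow, if_neg (by omega), smul_zero]

/-- Expanding the right side gives a double sum of $\frac{(t/2)^m}{m!}\frac{(s/2)^k}{k!}$ with
vectors depending only on $m+k$. Collecting by $m+k$ gives $e^{t/2}e^{s/2}=e^{(s+t)/2}$
coefficientwise. Only diagonal values of the functionals and the one vector `a` enter. -/
theorem gaussOp_comp_divPow {A A' A'' : H →L[ℂ] H} {β β' β'' : HTensor H H →L[ℂ] ℂ} {a : H}
    (hA : A'' a = A' (A a)) (hβ : β'' (htmul a a) = β' (htmul (A a) (A a)) + β (htmul a a))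
    (n : ℕ) :
    gaussOp A'' β'' (divPow n a) = gaussOp A' β' (gaussOp A β (divPow n a)) := by
  rw [gaussOp_divPow A β n.lt_succ_self, map_sum, gaussOp_divPow A'' β'' n.lt_succ_self]
  simp only [map_smul, gaussOp_lowDivPow A' β' n.lt_succ_self, Finset.smul_sum, smul_smul, hA, hβ]
  generalize β' (htmul (A a) (A a)) = s
  generalize β (htmul a a) = t
  -- The square index range overshoots the triangle $m+k\le n$; the surplus terms are zero because
  -- the degree would be negative.
  have hz : ∀ p ∈ Finset.range (n + 1) ×ˢ Finset.range (n + 1), p.1 + p.2 ∉ Finset.range (n + 1) →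
      ((p.1.factorial : ℂ)⁻¹ * (t / 2) ^ p.1 * ((p.2.factorial : ℂ)⁻¹ * (s / 2) ^ p.2)) •
        lowDivPow n (p.1 + p.2) (A' (A a)) = 0 := by
    intro p _ hp
    rw [lowDivPow_eq_zero (by simpa using hp), smul_zero]
  rw [← Finset.sum_product' (Finset.range (n + 1)) (Finset.range (n + 1)) fun m k =>
    ((m.factorial : ℂ)⁻¹ * (t / 2) ^ m * ((k.factorial : ℂ)⁻¹ * (s / 2) ^ k)) •
        lowDivPow n (m + k) (A' (A a))]
  rw [← Finset.sum_filter_of_ne (p := fun p => p.1 + p.2 ∈ Finset.range (n + 1))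
    fun p hp hne => not_imp_comm.1 (hz p hp) hne]
  rw [← Finset.sum_fiberwise_of_maps_to (g := fun p : ℕ × ℕ => p.1 + p.2)
    (fun p hp => (Finset.mem_filter.1 hp).2)]
  refine Finset.sum_congr rfl fun m hm => ?_
  have hanti : ((Finset.range (n + 1) ×ˢ Finset.range (n + 1)).filter
      (fun p => p.1 + p.2 ∈ Finset.range (n + 1))).filter (fun p => p.1 + p.2 = m)
      = Finset.HasAntidiagonal.antidiagonal m := by
    ext p
    simp only [Finset.mem_filter, Finset.mem_product, Finset.mem_range, Finset.HasAntidiagonal.mem_antidiagonal]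
      at hm ⊢
    omega
  rw [hanti, Finset.sum_congr rfl (g := fun p : ℕ × ℕ => ((p.1.factorial : ℂ)⁻¹ * (t / 2) ^ p.1 *
    ((p.2.factorial : ℂ)⁻¹ * (s / 2) ^ p.2)) • lowDivPow n m (A' (A a))), ← Finset.sum_smul]
  · congr 1
    -- Binomial theorem for $((t+s)/2)^m/m!$, summed over the antidiagonal.
    rw [add_comm s t, add_div, (Commute.all (t / 2) (s / 2)).add_pow', Finset.mul_sum]
    refine Finset.sum_congr rfl fun p hp => ?_
    rw [Finset.HasAntidiagonal.mem_antidiagonal] at hp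
    have h := Nat.add_choose_mul_factorial_mul_factorial p.2 p.1
    rw [add_comm, hp] at h
    have h' : (m.choose p.1 : ℂ) * p.2.factorial * p.1.factorial = m.factorial := by
      exact_mod_cast h
    have h1 : (p.1.factorial : ℂ) ≠ 0 := Nat.cast_ne_zero.2 p.1.factorial_ne_zero
    have h2 : (p.2.factorial : ℂ) ≠ 0 := Nat.cast_ne_zero.2 p.2.factorial_ne_zero
    have h3 : (m.factorial : ℂ) ≠ 0 := Nat.cast_ne_zero.2 m.factorial_ne_zero
    rw [nsmul_eq_mul]
    field_simp
    rw [← h']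
    ring
  · intro p hp
    rw [Finset.HasAntidiagonal.mem_antidiagonal.1 hp]

/-! ### Degreewise bounded operators -/

/-- Operators that do not raise degrees and are continuous between homogeneous components. -/
def DegBounded (f : Module.End ℂ (TensorAlg H)) : Prop :=
  ∀ p, (∀ q, p < q → ∀ x, f (DirectSum.lof ℂ ℕ (fun p => TPow H p) p x) q = 0) ∧
    ∀ q, Continuous fun x => f (DirectSum.lof ℂ ℕ (fun p => TPow H p) p x) q

theorem eq_sum_lof {x : TensorAlg H} {p : ℕ} (h : ∀ q, p < q → x q = 0) :
    x = ∑ q ∈ Finset.range (p + 1), DirectSum.lof ℂ ℕ (fun p => TPow H p) q (x q) := by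
  refine DFinsupp.ext fun r => ?_
  rw [DFinsupp.finsetSum_apply]
  by_cases hr : r < p + 1
  · rw [Finset.sum_eq_single r]
    · exact (DirectSum.lof_apply ℂ r (x r)).symm
    · intro q _ hq
      exact DFinsupp.single_eq_of_ne hq.symm
    · intro hr'
      exact absurd (Finset.mem_range.2 hr) hr'
  · rw [h r (by omega), Finset.sum_eq_zero]
    intro q hq
    refine DFinsupp.single_eq_of_ne ?_
    have := Finset.mem_range.1 hq
    omega

/-- Since `g` does not raise degrees, a component of the composite on degree `p` is a sum over the
finitely many intermediate degrees `r ≤ p`, a range independent of the vector; continuity is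
therefore preserved. -/
theorem DegBounded.comp {f g : Module.End ℂ (TensorAlg H)} (hf : DegBounded f)
    (hg : DegBounded g) : DegBounded (f ∘ₗ g) := by
  intro p
  have key : ∀ x q, (f ∘ₗ g) (DirectSum.lof ℂ ℕ (fun p => TPow H p) p x) q
      = ∑ r ∈ Finset.range (p + 1), f (DirectSum.lof ℂ ℕ (fun p => TPow H p) r
        (g (DirectSum.lof ℂ ℕ (fun p => TPow H p) p x) r)) q := by
    intro x q
    rw [LinearMap.comp_apply]
    conv_lhs => rw [eq_sum_lof (fun q hq => (hg p).1 q hq x), map_sum]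
    exact DFinsupp.finsetSum_apply _ _ _
  refine ⟨fun q hq x => ?_, fun q => ?_⟩
  · rw [key]
    refine Finset.sum_eq_zero fun r hr => (hf r).1 q ?_ _
    have := Finset.mem_range.1 hr
    omega
  · simp only [key]
    exact continuous_finsetSum _ fun r _ => ((hf r).2 q).comp ((hg p).2 r)

theorem DegBounded.one : DegBounded (1 : Module.End ℂ (TensorAlg H)) := by
  refine fun p => ⟨fun q hq x => DFinsupp.single_eq_of_ne hq.ne', fun q => ?_⟩
  by_cases h : p = q
  · subst h
    simp only [Module.End.one_apply, DirectSum.lof_apply]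
    exact continuous_id
  · have : ∀ x : TPow H p, (DirectSum.lof ℂ ℕ (fun p => TPow H p) p x) q = 0 := fun x =>
      DFinsupp.single_eq_of_ne (Ne.symm h)
    simp only [Module.End.one_apply, this]
    exact continuous_const

theorem DegBounded.pow {f : Module.End ℂ (TensorAlg H)} (hf : DegBounded f) (m : ℕ) :
    DegBounded (f ^ m) := by
  induction m with
  | zero => exact DegBounded.one
  | succ m ih => rw [pow_succ]; exact ih.comp hf

theorem degBounded_lof {f : Module.End ℂ (TensorAlg H)} {p q : ℕ} (hqp : q ≤ p)
    (L : TPow H p →L[ℂ] TPow H q)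
    (hL : ∀ x, f (DirectSum.lof ℂ ℕ (fun p => TPow H p) p x) =
      DirectSum.lof ℂ ℕ (fun p => TPow H p) q (L x)) :
    (∀ r, p < r → ∀ x, f (DirectSum.lof ℂ ℕ (fun p => TPow H p) p x) r = 0) ∧
    ∀ r, Continuous fun x => f (DirectSum.lof ℂ ℕ (fun p => TPow H p) p x) r := by
  have h1 := DegBounded.one (H := H) q
  simp only [hL]
  exact ⟨fun r hr x => h1.1 r (by omega) _, fun r => (h1.2 r).comp L.continuous⟩

theorem DegBounded.tensorAlgMap (A : H →L[ℂ] H) : DegBounded (tensorAlgMap A) := fun p =>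
  degBounded_lof le_rfl (tensorMap A p) fun x => by
    rw [BergmanCE.tensorAlgMap, DirectSum.lmap_lof]
    rfl

theorem DegBounded.contractAlg (β : HTensor H H →L[ℂ] ℂ) : DegBounded (contractAlg β) := by
  intro p
  match p with
  | 0 =>
    exact degBounded_lof le_rfl 0 fun x => by
      rw [BergmanCE.contractAlg, DirectSum.toModule_lof]
      exact (map_zero (DirectSum.lof ℂ ℕ (fun p => TPow H p) 0)).symm
  | 1 =>
    exact degBounded_lof le_rfl 0 fun x => by
      rw [BergmanCE.contractAlg, DirectSum.toModule_lof]
      exact (map_zero (DirectSum.lof ℂ ℕ (fun p => TPow H p) 1)).symm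
  | p + 2 =>
    exact degBounded_lof (Nat.le_add_right p 2) (contract β p) fun x => by
      rw [BergmanCE.contractAlg, DirectSum.toModule_lof]
      rfl

theorem DegBounded.expContract (β : HTensor H H →L[ℂ] ℂ) : DegBounded (expContract β) := by
  intro p
  have key : ∀ x q, BergmanCE.expContract β (DirectSum.lof ℂ ℕ (fun p => TPow H p) p x) q
      = ∑ m ∈ Finset.range (p + 1), ((m.factorial : ℂ)⁻¹) •
        (BergmanCE.contractAlg β ^ m) (DirectSum.lof ℂ ℕ (fun p => TPow H p) p x) q := by
    intro x q
    rw [expContract_lof]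
    exact DFinsupp.finsetSum_apply _ _ _
  have h := fun m => (DegBounded.contractAlg β).pow m p
  refine ⟨fun q hq x => ?_, fun q => ?_⟩
  · rw [key]
    refine Finset.sum_eq_zero fun m _ => ?_
    rw [(h m).1 q hq, smul_zero]
  · simp only [key]
    exact continuous_finsetSum _ fun m _ => ((h m).2 q).const_smul _

theorem DegBounded.gaussOp (A : H →L[ℂ] H) (β : HTensor H H →L[ℂ] ℂ) :
    DegBounded (gaussOp A β) :=
  (DegBounded.tensorAlgMap A).comp (DegBounded.expContract β)

/-- Degreewise bounded operators that agree on divided powers agree on symmetric tensors. -/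
theorem DegBounded.eqOn {f g : Module.End ℂ (TensorAlg H)} (hf : DegBounded f)
    (hg : DegBounded g) (h : ∀ n a, f (divPow n a) = g (divPow n a)) (x : FockSym H) :
    f (FockSym.incl x) = g (FockSym.incl x) := by
  suffices f ∘ₗ FockSym.incl = g ∘ₗ FockSym.incl from LinearMap.congr_fun this x
  refine DirectSum.linearMap_ext ℂ fun p => LinearMap.ext fun y => ?_
  simp only [LinearMap.comp_apply, FockSym.incl, DirectSum.lmap_lof, Submodule.subtype_apply]
  refine DFinsupp.ext fun q => ?_
  -- For a fixed input degree `p` and output degree `q` the agreement locus is a closed subspace, so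
  -- containing all powers forces it to contain $\mathrm{Sym}^p$.
  let S : Submodule ℂ (TPow H p) := LinearMap.eqLocus
    (DirectSum.component ℂ ℕ (fun p => TPow H p) q ∘ₗ f ∘ₗ DirectSum.lof ℂ ℕ (fun p => TPow H p) p)
    (DirectSum.component ℂ ℕ (fun p => TPow H p) q ∘ₗ g ∘ₗ DirectSum.lof ℂ ℕ (fun p => TPow H p) p)
  have hS : IsClosed (S : Set (TPow H p)) := isClosed_eq ((hf p).2 q) ((hg p).2 q)
  refine symPow_le hS (fun a => ?_) y.2
  have h1 := h p a
  rw [divPow, map_smul, map_smul] at h1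
  have h2 := smul_right_injective _ (inv_ne_zero (Nat.cast_ne_zero.2 p.factorial_ne_zero)) h1
  exact congrArg (fun x : TensorAlg H => x q) h2

theorem mem_range_incl_iff (x : TensorAlg H) :
    x ∈ LinearMap.range (FockSym.incl (H := H)) ↔ ∀ p, x p ∈ SymPow H p := by
  constructor
  · rintro ⟨y, rfl⟩ p
    rw [FockSym.incl, DirectSum.lmap_apply]
    exact (y p).2
  · intro h
    classical
    refine ⟨DFinsupp.mk x.support fun p => ⟨x p, h p⟩, DFinsupp.ext fun p => ?_⟩
    rw [FockSym.incl, DirectSum.lmap_apply, DFinsupp.mk_apply]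
    split_ifs with hp
    · rfl
    · simpa using (DFinsupp.notMem_support_iff.1 hp).symm

theorem incl_injective : Function.Injective (FockSym.incl (H := H)) :=
  (DirectSum.lmap_injective _).2 fun _ => Subtype.val_injective

/-- Degreewise bounded operators that map divided powers to symmetric tensors preserve symmetric
tensors. -/
theorem DegBounded.mem_range {f : Module.End ℂ (TensorAlg H)} (hf : DegBounded f)
    (h : ∀ n a q, f (divPow n a) q ∈ SymPow H q) {x : TensorAlg H}
    (hx : x ∈ LinearMap.range (FockSym.incl (H := H))) :
    f x ∈ LinearMap.range (FockSym.incl (H := H)) := by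
  obtain ⟨y, rfl⟩ := hx
  rw [mem_range_incl_iff]
  intro q
  induction y using DirectSum.induction_on with
  | zero => rw [map_zero, map_zero]; exact Submodule.zero_mem _
  | add y z hy hz => rw [map_add, map_add]; exact Submodule.add_mem _ hy hz
  | of p y =>
    have e : FockSym.incl (DirectSum.of (fun p => SymPow H p) p y)
        = DirectSum.lof ℂ ℕ (fun p => TPow H p) p y :=
      DirectSum.lmap_lof (fun p => (SymPow H p).subtype) p y
    rw [e]
    -- The same closure argument, for the preimage of the closed subspace $\mathrm{Sym}^q$.
    let S : Submodule ℂ (TPow H p) := (SymPow H q).comap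
      (DirectSum.component ℂ ℕ (fun p => TPow H p) q ∘ₗ f ∘ₗ
        DirectSum.lof ℂ ℕ (fun p => TPow H p) p)
    have hS : IsClosed (S : Set (TPow H p)) := (isClosed_symPow q).preimage ((hf p).2 q)
    refine symPow_le hS (fun a => ?_) y.2
    have h1 := h p a q
    rw [divPow, map_smul] at h1
    exact (Submodule.smul_mem_iff (SymPow H q)
      (inv_ne_zero (Nat.cast_ne_zero.2 p.factorial_ne_zero))).1 h1

theorem divPow_apply_mem (n q : ℕ) (a : H) : divPow n a q ∈ SymPow H q := by
  refine (mem_range_incl_iff _).1 ⟨((n.factorial : ℂ)⁻¹) •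
    DirectSum.lof ℂ ℕ (fun p => SymPow H p) n ⟨tpow n a, tpow_mem_symPow n a⟩, ?_⟩ q
  rw [map_smul, FockSym.incl, DirectSum.lmap_lof]
  rfl

theorem gaussOp_mem_range (A : H →L[ℂ] H) (β : HTensor H H →L[ℂ] ℂ) {x : TensorAlg H}
    (hx : x ∈ LinearMap.range (FockSym.incl (H := H))) :
    gaussOp A β x ∈ LinearMap.range (FockSym.incl (H := H)) := by
  refine (DegBounded.gaussOp A β).mem_range (fun n a q => ?_) hx
  rw [gaussOp_divPow A β n.lt_succ_self]
  refine (mem_range_incl_iff _).1 (Submodule.sum_mem _ fun m _ => Submodule.smul_mem _ _ ?_) q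
  unfold lowDivPow
  split_ifs
  · exact (mem_range_incl_iff _).2 fun q => divPow_apply_mem _ q _
  · exact Submodule.zero_mem _

end GaussOp

/-! ### The representation on symmetric tensors and on bounded degree -/

section FockRepresentation

variable {H : Type} [NormedAddCommGroup H] [InnerProductSpace ℂ H] [CompleteSpace H]

/-- The restriction of `A^{⊗} ∘ exp(∂_β)` to `Sym H`. -/
def fockOp (A : H →L[ℂ] H) (β : HTensor H H →L[ℂ] ℂ) : Module.End ℂ (FockSym H) :=
  (LinearEquiv.ofInjective FockSym.incl incl_injective).symm.toLinearMap ∘ₗ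
    ((gaussOp A β).restrict fun _ hx => gaussOp_mem_range A β hx) ∘ₗ
      (LinearEquiv.ofInjective FockSym.incl incl_injective).toLinearMap

theorem incl_fockOp (A : H →L[ℂ] H) (β : HTensor H H →L[ℂ] ℂ) (x : FockSym H) :
    FockSym.incl (fockOp A β x) = gaussOp A β (FockSym.incl x) := by
  have h := LinearEquiv.apply_symm_apply (LinearEquiv.ofInjective FockSym.incl incl_injective)
    (((gaussOp A β).restrict fun _ hx => gaussOp_mem_range A β hx)
      (LinearEquiv.ofInjective FockSym.incl incl_injective x))
  exact congrArg Subtype.val h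

theorem coe_fockOp_apply (A : H →L[ℂ] H) (β : HTensor H H →L[ℂ] ℂ) (x : FockSym H) (q : ℕ) :
    (fockOp A β x q : TPow H q) = gaussOp A β (FockSym.incl x) q := by
  rw [← incl_fockOp]
  rfl

/-- On symmetric tensors only the values of `β` on squares `a ⊗ a` matter. If these vanish, the
exponential series on a divided power retains only its term `m = 0`, which `Finset.sum_range_succ'`
splits off. -/
theorem fockOp_one {β : HTensor H H →L[ℂ] ℂ} (hβ : ∀ a, β (htmul a a) = 0) :
    fockOp 1 β = 1 := by
  refine LinearMap.ext fun x => incl_injective ?_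
  rw [incl_fockOp]
  refine (DegBounded.gaussOp 1 β).eqOn DegBounded.one (fun n a => ?_) x
  rw [gaussOp_divPow _ _ n.lt_succ_self, Finset.sum_range_succ', Finset.sum_eq_zero]
  · simp [lowDivPow_zero]
  · intro m _
    simp [hβ]

theorem fockOp_mul {A A' : H →L[ℂ] H} {β β' β'' : HTensor H H →L[ℂ] ℂ}
    (hβ : ∀ a, β'' (htmul a a) = β' (htmul (A a) (A a)) + β (htmul a a)) :
    fockOp (A' * A) β'' = fockOp A' β' * fockOp A β := by
  refine LinearMap.ext fun x => incl_injective ?_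
  rw [Module.End.mul_apply, incl_fockOp, incl_fockOp, incl_fockOp]
  exact (DegBounded.gaussOp _ _).eqOn ((DegBounded.gaussOp _ _).comp (DegBounded.gaussOp _ _))
    (fun n a => gaussOp_comp_divPow rfl (hβ a) n) x

/-- As for `fockOp_one`, only the term `m = 0` remains; this reduces the Möbius case to plain tensor
powers. -/
theorem gaussOp_incl_of_eq_zero (A : H →L[ℂ] H) {β : HTensor H H →L[ℂ] ℂ}
    (hβ : ∀ a, β (htmul a a) = 0) (x : FockSym H) :
    gaussOp A β (FockSym.incl x) = tensorAlgMap A (FockSym.incl x) := by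
  refine (DegBounded.gaussOp A β).eqOn (DegBounded.tensorAlgMap A) (fun n a => ?_) x
  rw [gaussOp_divPow _ _ n.lt_succ_self, Finset.sum_range_succ', Finset.sum_eq_zero]
  · simp [lowDivPow_zero, tensorAlgMap_divPow]
  · intro m _
    simp [hβ]

/-- The projection of `Sym H` onto the degrees at most `k`. -/
def SymFil.proj (k : ℕ) : FockSym H →ₗ[ℂ] SymFil H k where
  toFun x := WithLp.toLp 2 fun p => x p
  map_add' _ _ := rfl
  map_smul' _ _ := rfl

theorem SymFil.proj_apply (k : ℕ) (x : FockSym H) (p : Fin (k + 1)) :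
    SymFil.proj k x p = x p := rfl

theorem SymFil.incl_apply (k : ℕ) (x : SymFil H k) (p : Fin (k + 1)) :
    SymFil.incl k x p = x p := by
  change (∑ q : Fin (k + 1), DirectSum.lof ℂ ℕ (fun p => SymPow H p) q (x q)) p = x p
  rw [DFinsupp.finsetSum_apply, Finset.sum_eq_single p]
  · exact DirectSum.lof_apply (M := fun p => SymPow H p) ℂ (p : ℕ) (x p)
  · intro q _ hq
    exact DFinsupp.single_eq_of_ne fun h => hq (Fin.ext h.symm)
  · simp

theorem SymFil.incl_apply_of_lt {k q : ℕ} (hq : k < q) (x : SymFil H k) :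
    SymFil.incl k x q = 0 := by
  change (∑ p : Fin (k + 1), DirectSum.lof ℂ ℕ (fun p => SymPow H p) p (x p)) q = 0
  rw [DFinsupp.finsetSum_apply, Finset.sum_eq_zero]
  intro p _
  exact DFinsupp.single_eq_of_ne (by have := p.2; omega)

theorem SymFil.incl_injective (k : ℕ) : Function.Injective (SymFil.incl (H := H) k) := by
  intro x y h
  refine PiLp.ext fun p => ?_
  rw [← SymFil.incl_apply, h, SymFil.incl_apply]

theorem SymFil.incl_proj {k : ℕ} {x : FockSym H} (hx : ∀ q, k < q → x q = 0) :
    SymFil.incl k (SymFil.proj k x) = x := by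
  refine DFinsupp.ext fun q => ?_
  by_cases hq : k < q
  · rw [hx q hq]
    exact SymFil.incl_apply_of_lt hq _
  · exact SymFil.incl_apply k _ ⟨q, by omega⟩

theorem gaussOp_incl_incl (A : H →L[ℂ] H) (β : HTensor H H →L[ℂ] ℂ) (k q : ℕ) (x : SymFil H k) :
    gaussOp A β (FockSym.incl (SymFil.incl k x)) q = ∑ p : Fin (k + 1),
      gaussOp A β (DirectSum.lof ℂ ℕ (fun p => TPow H p) p (x p : TPow H p)) q := by
  have h : FockSym.incl (SymFil.incl k x)
      = ∑ p : Fin (k + 1), DirectSum.lof ℂ ℕ (fun p => TPow H p) p (x p : TPow H p) := by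
    change FockSym.incl (∑ p : Fin (k + 1), DirectSum.lof ℂ ℕ (fun p => SymPow H p) p (x p)) = _
    rw [map_sum]
    refine Finset.sum_congr rfl fun p _ => ?_
    rw [FockSym.incl, DirectSum.lmap_lof]
    rfl
  rw [h, map_sum]
  exact DFinsupp.finsetSum_apply _ _ _

/-- The restriction of `A^{⊗} ∘ exp(∂_β)` to `⨁_{p ≤ k} Symᵖ H`. -/
def symFilOp (A : H →L[ℂ] H) (β : HTensor H H →L[ℂ] ℂ) (k : ℕ) : SymFil H k →L[ℂ] SymFil H k where
  toLinearMap := SymFil.proj k ∘ₗ fockOp A β ∘ₗ SymFil.incl k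
  cont := by
    refine (PiLp.continuous_toLp 2 _).comp (continuous_pi fun q => ?_)
    -- $\mathrm{Sym}^q$ carries the topology induced from $H^{\otimes q}$, and there the component
    -- is a finite sum of continuous maps, one for each input degree.
    refine continuous_induced_rng.2 ?_
    have h : ∀ x : SymFil H k, (fockOp A β (SymFil.incl k x) q : TPow H q) = ∑ p : Fin (k + 1),
        gaussOp A β (DirectSum.lof ℂ ℕ (fun p => TPow H p) p (x p : TPow H p)) q := fun x => by
      rw [coe_fockOp_apply, gaussOp_incl_incl]
    refine (continuous_finsetSum _ fun p _ => ?_).congr fun x => (h x).symm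
    exact ((DegBounded.gaussOp A β p).2 q).comp
      (continuous_subtype_val.comp (PiLp.continuous_apply 2 _ p))

theorem symFilOp_apply (A : H →L[ℂ] H) (β : HTensor H H →L[ℂ] ℂ) (k : ℕ) (x : SymFil H k) :
    symFilOp A β k x = SymFil.proj k (fockOp A β (SymFil.incl k x)) := rfl

/-- The projection to degrees at most `k` loses nothing because degrees are not raised.
Multiplicativity on the truncation can therefore be read off from that of `fockOp`. -/
theorem incl_symFilOp (A : H →L[ℂ] H) (β : HTensor H H →L[ℂ] ℂ) (k : ℕ) (x : SymFil H k) :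
    SymFil.incl k (symFilOp A β k x) = fockOp A β (SymFil.incl k x) := by
  refine SymFil.incl_proj fun q hq => Subtype.ext ?_
  change (fockOp A β (SymFil.incl k x) q : TPow H q) = 0
  rw [coe_fockOp_apply, gaussOp_incl_incl]
  refine Finset.sum_eq_zero fun p _ => (DegBounded.gaussOp A β p).1 q ?_ _
  have := p.2
  omega

theorem coe_symFilOp_apply (A : H →L[ℂ] H) {β : HTensor H H →L[ℂ] ℂ}
    (hβ : ∀ a, β (htmul a a) = 0) (k : ℕ) (x : SymFil H k) (p : Fin (k + 1)) :
    (symFilOp A β k x p : TPow H p) = tensorMap A p (x p) := by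
  rw [symFilOp_apply, SymFil.proj_apply, coe_fockOp_apply, gaussOp_incl_of_eq_zero A hβ,
    tensorAlgMap, DirectSum.lmap_apply]
  change tensorMap A p (SymFil.incl k x p : TPow H p) = _
  rw [SymFil.incl_apply]

variable {M : Type*} [Monoid M] (A : M →* (H →L[ℂ] H)) (β : M → HTensor H H →L[ℂ] ℂ)
  (hone : ∀ a, β 1 (htmul a a) = 0)
  (hmul : ∀ φ ψ a, β (φ * ψ) (htmul a a) = β φ (htmul (A ψ a) (A ψ a)) + β ψ (htmul a a))

/-- The representation on `Sym H` given by a representation on `H` and a cocycle with values in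
the functionals on `H ⊗ H`. -/
def fockRep : M →* Module.End ℂ (FockSym H) where
  toFun φ := fockOp (A φ) (β φ)
  map_one' := by rw [map_one, fockOp_one hone]
  map_mul' φ ψ := by rw [map_mul, fockOp_mul (hmul φ ψ)]

/-- The restriction of `fockRep` to the degrees at most `k`. -/
def symFilRep (k : ℕ) : M →* (SymFil H k →L[ℂ] SymFil H k) where
  toFun φ := symFilOp (A φ) (β φ) k
  map_one' := ContinuousLinearMap.ext fun x => SymFil.incl_injective k (by
    rw [incl_symFilOp, map_one, fockOp_one hone]
    rfl)
  map_mul' φ ψ := ContinuousLinearMap.ext fun x => SymFil.incl_injective k (by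
    rw [mul_apply_eq_comp, incl_symFilOp, incl_symFilOp, incl_symFilOp, map_mul,
      fockOp_mul (hmul φ ψ)]
    rfl)

end FockRepresentation

/-! ### Unitarity and strong continuity of second quantization -/

section Unitary

variable {H : Type} [NormedAddCommGroup H] [InnerProductSpace ℂ H] [CompleteSpace H]

/-- For pure tensors the inner product is a product of inner products. Continuity and totality of
pure tensors extend the identity, one argument at a time. -/
theorem inner_tensorMap {A : H →L[ℂ] H} (hA : ∀ a b, inner ℂ (A a) (A b) = inner ℂ a b) (n : ℕ)
    (x y : TPow H n) : inner ℂ (tensorMap A n x) (tensorMap A n y) = inner ℂ x y := by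
  have h1 : ∀ (b : Fin n → H) (x : TPow H n),
      inner ℂ (tensorMap A n (tprod b)) (tensorMap A n x) = inner ℂ (tprod b) x := by
    intro b x
    have : (innerSL ℂ (tensorMap A n (tprod b))).comp (tensorMap A n) = innerSL ℂ (tprod b) :=
      clm_ext_tprod fun a => by
        simp only [ContinuousLinearMap.comp_apply, innerSL_apply_apply, tensorMap_tprod,
          inner_tprod, hA]
    exact DFunLike.congr_fun this x
  have : (innerSL ℂ (tensorMap A n x)).comp (tensorMap A n) = innerSL ℂ x :=
    clm_ext_tprod fun b => by
      simp only [ContinuousLinearMap.comp_apply, innerSL_apply_apply]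
      rw [← inner_conj_symm, h1, inner_conj_symm]
  exact DFunLike.congr_fun this y

theorem inner_symFilOp {A : H →L[ℂ] H} (hA : ∀ a b, inner ℂ (A a) (A b) = inner ℂ a b)
    {β : HTensor H H →L[ℂ] ℂ} (hβ : ∀ a, β (htmul a a) = 0) (k : ℕ) (x y : SymFil H k) :
    inner ℂ (symFilOp A β k x) (symFilOp A β k y) = inner ℂ x y := by
  rw [PiLp.inner_apply, PiLp.inner_apply]
  refine Finset.sum_congr rfl fun p _ => ?_
  rw [Submodule.coe_inner, Submodule.coe_inner, coe_symFilOp_apply A hβ, coe_symFilOp_apply A hβ,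
    inner_tensorMap hA]

/-- Preserving inner products gives $u^*u=1$; a left inverse and a right inverse coincide, so
$v=u^*$ and $uu^*=1$. -/
theorem mem_unitary_of_inner_of_mul_eq_one {E : Type*} [NormedAddCommGroup E]
    [InnerProductSpace ℂ E] [CompleteSpace E] {u v : E →L[ℂ] E}
    (hu : ∀ x y, inner ℂ (u x) (u y) = inner ℂ x y) (huv : u * v = 1) :
    u ∈ unitary (E →L[ℂ] E) := by
  have h1 : star u * u = 1 := by
    refine ContinuousLinearMap.ext fun x => ext_inner_right ℂ fun y => ?_
    rw [mul_apply_eq_comp, ContinuousLinearMap.star_eq_adjoint,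
      ContinuousLinearMap.adjoint_inner_left, hu]
    rfl
  refine ⟨h1, ?_⟩
  rw [left_inv_eq_right_inv h1 huv, huv]

theorem symFilRep_mem_unitary {M : Type*} [Monoid M] {A : M →* (H →L[ℂ] H)}
    {β : M → HTensor H H →L[ℂ] ℂ} (hone : ∀ a, β 1 (htmul a a) = 0)
    (hmul : ∀ φ ψ a, β (φ * ψ) (htmul a a) = β φ (htmul (A ψ a) (A ψ a)) + β ψ (htmul a a))
    {g : M} (hg : ∃ h, g * h = 1) (hA : ∀ a b, inner ℂ (A g a) (A g b) = inner ℂ a b)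
    (hβ : ∀ a, β g (htmul a a) = 0) (k : ℕ) :
    symFilRep A β hone hmul k g ∈ unitary (SymFil H k →L[ℂ] SymFil H k) := by
  obtain ⟨h, hgh⟩ := hg
  exact mem_unitary_of_inner_of_mul_eq_one (v := symFilRep A β hone hmul k h)
    (inner_symFilOp hA hβ k) (by rw [← map_mul, hgh, map_one])

/-- On combinations of pure tensors this is the continuity of `tprod`. Because the operators are
isometric, approximating `x` by such a combination is uniform in `t`, and uniform limits of
continuous functions are continuous. -/
theorem continuous_tensorMap {X : Type*} [TopologicalSpace X] {A : X → H →L[ℂ] H}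
    (hA : ∀ t a b, inner ℂ (A t a) (A t b) = inner ℂ a b)
    (hc : ∀ a, Continuous fun t => A t a) (n : ℕ) (x : TPow H n) :
    Continuous fun t => tensorMap (A t) n x := by
  have hx : x ∈ (Submodule.span ℂ (Set.range (tprod : (Fin n → H) → TPow H n))).topologicalClosure :=
    dense_tprod (H := H) n ▸ Submodule.mem_top
  have hspan : ∀ y ∈ Submodule.span ℂ (Set.range (tprod : (Fin n → H) → TPow H n)),
      Continuous fun t => tensorMap (A t) n y := by
    intro y hy
    induction hy using Submodule.span_induction with
    | mem y hy =>
      obtain ⟨a, rfl⟩ := hy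
      simp only [tensorMap_tprod]
      exact (continuous_tprod n).comp (continuous_pi fun i => hc (a i))
    | zero => simpa using continuous_const
    | add y z _ _ hy hz =>
      simp only [map_add]
      exact hy.add hz
    | smul c y _ hy =>
      simp only [map_smul]
      exact hy.const_smul c
  refine continuous_of_uniform_approx_of_continuous fun u hu => ?_
  obtain ⟨ε, hε, hεu⟩ := Metric.mem_uniformity_dist.1 hu
  obtain ⟨y, hy, hxy⟩ := Metric.mem_closure_iff.1 hx ε hε
  refine ⟨_, hspan y hy, fun t => hεu ?_⟩
  have hn : ∀ z, ‖tensorMap (A t) n z‖ = ‖z‖ := fun z => by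
    have := inner_tensorMap (hA t) n z z
    rw [inner_self_eq_norm_sq_to_K, inner_self_eq_norm_sq_to_K] at this
    exact (sq_eq_sq₀ (norm_nonneg _) (norm_nonneg _)).1 (by exact_mod_cast this)
  rwa [dist_eq_norm, ← map_sub, hn, ← dist_eq_norm]

theorem continuous_symFilOp {X : Type*} [TopologicalSpace X] {A : X → H →L[ℂ] H}
    (hA : ∀ t a b, inner ℂ (A t a) (A t b) = inner ℂ a b)
    (hc : ∀ a, Continuous fun t => A t a) {β : X → HTensor H H →L[ℂ] ℂ}
    (hβ : ∀ t a, β t (htmul a a) = 0) (k : ℕ) (x : SymFil H k) :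
    Continuous fun t => symFilOp (A t) (β t) k x := by
  have h : Continuous fun t => (fun p : Fin (k + 1) => symFilOp (A t) (β t) k x p) := by
    refine continuous_pi fun p => continuous_induced_rng.2 ?_
    refine (continuous_tensorMap hA hc p (x p)).congr fun t => ?_
    exact (coe_symFilOp_apply (A t) (hβ t) k x p).symm
  exact (PiLp.continuous_toLp 2 _).comp h

/-- Isometries that depend weakly continuously on a parameter depend strongly continuously on
it. -/
theorem continuous_of_inner_of_weak {E X : Type*} [NormedAddCommGroup E]
    [InnerProductSpace ℂ E] [TopologicalSpace X] {A : X → E →L[ℂ] E}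
    (hA : ∀ t a, ‖A t a‖ = ‖a‖) (hc : ∀ a b, Continuous fun t => inner ℂ (A t a) b) (a : E) :
    Continuous fun t => A t a := by
  rw [continuous_iff_continuousAt]
  intro s
  rw [ContinuousAt, tendsto_iff_norm_sub_tendsto_zero]
  -- For isometries $\|A_ta-A_sa\|^2=2\|a\|^2-2\,\mathrm{Re}\langle A_ta,A_sa\rangle$, which tends
  -- to 0 by weak continuity tested against the fixed vector $A_sa$.
  have h1 : Tendsto (fun t => 2 * ‖a‖ ^ 2 - 2 * (inner ℂ (A t a) (A s a)).re) (𝓝 s)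
      (𝓝 (2 * ‖a‖ ^ 2 - 2 * (inner ℂ (A s a) (A s a)).re)) :=
    ((Complex.continuous_re.comp (hc a (A s a))).tendsto s).const_mul 2 |>.const_sub _
  have h2 : ∀ t, ‖A t a - A s a‖ = √(2 * ‖a‖ ^ 2 - 2 * (inner ℂ (A t a) (A s a)).re) := by
    intro t
    rw [← Real.sqrt_sq (norm_nonneg (A t a - A s a)), @norm_sub_sq ℂ, hA, hA]
    congr 1
    simp only [RCLike.re_to_complex]
    ring
  have h3 : 2 * ‖a‖ ^ 2 - 2 * (inner ℂ (A s a) (A s a)).re = 0 := by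
    have := @norm_sq_eq_re_inner ℂ _ _ _ _ (A s a)
    rw [hA] at this
    rw [this]
    simp
  rw [h3] at h1
  have h4 := (Real.continuous_sqrt.tendsto 0).comp h1
  rw [Real.sqrt_zero] at h4
  exact h4.congr fun t => (h2 t).symm

end Unitary

/-! ### Slices of the kernel and the classical representation -/

section Cocycle

theorem F_swap (φ : CEemb) (z w : ℂ) : F φ (z, w) = F φ (w, z) := by
  simp only [F]
  rw [← neg_sub (fn φ z), ← neg_sub z, neg_sq, neg_sq, mul_comm]

/-- The singularity of `F_φ` on the diagonal is removable. -/
theorem exists_F_eq (φ : CEemb) {w : ℂ} (hw : w ∈ ball (0 : ℂ) 1) (h0 : deriv (fn φ) w ≠ 0) :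
    ∃ g : ℂ → ℂ, DifferentiableOn ℂ g (ball 0 1) ∧ ∀ z ∈ ball (0 : ℂ) 1, z ≠ w →
      F φ (z, w) = g z := by
  have hU : ball (0 : ℂ) 1 ∈ 𝓝 w := isOpen_ball.mem_nhds hw
  -- The difference quotient $h(z)=(\varphi(z)-\varphi(w))/(z-w)$ has no zeros: off $w$ by
  -- injectivity, at $w$ by `h0`.
  set h : ℂ → ℂ := dslope (fn φ) w with hh
  have hd : DifferentiableOn ℂ h (ball 0 1) :=
    (Complex.differentiableOn_dslope hU).2 (fn_differentiableOn φ)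
  have hw' : h w = deriv (fn φ) w := dslope_same _ _
  have hsub : ∀ z, (z - w) * h z = fn φ z - fn φ w := fun z => sub_smul_dslope (fn φ) w z
  have hne : ∀ z ∈ ball (0 : ℂ) 1, h z ≠ 0 := by
    intro z hz hz0
    by_cases e : z = w
    · rw [e, hw'] at hz0; exact h0 hz0
    · have := hsub z
      rw [hz0, mul_zero, eq_comm, sub_eq_zero] at this
      exact e (fn_injOn φ hz hw this)
  have hder : ∀ z ∈ ball (0 : ℂ) 1, deriv (fn φ) z = h z + (z - w) * deriv h z := by
    intro z hz
    have h1 : HasDerivAt (fun z => (z - w) * h z) (1 * h z + (z - w) * deriv h z) z :=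
      ((hasDerivAt_id z).sub_const w).mul (hd.differentiableAt (isOpen_ball.mem_nhds hz)).hasDerivAt
    simp only [hsub] at h1
    have h2 := ((fn_differentiableOn φ).differentiableAt
      (isOpen_ball.mem_nhds hz)).hasDerivAt.sub_const (fn φ w)
    rw [h2.unique h1, one_mul]
  -- This is $\varphi'(z)\varphi'(w)-h(z)^2$, so that $F_\varphi(z,w)=n(z)/((z-w)^2h(z)^2)$ off the
  -- diagonal. It vanishes to second order at $w$: $n'(w)=2h'(w)h(w)-2h(w)h'(w)=0$.
  set n : ℂ → ℂ := fun z => (h z + (z - w) * deriv h z) * h w - h z ^ 2 with hn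
  have hd' : DifferentiableOn ℂ (deriv h) (ball 0 1) := hd.deriv isOpen_ball
  have hnd : DifferentiableOn ℂ n (ball 0 1) := by
    have h3 : DifferentiableOn ℂ (fun z : ℂ => z - w) (ball 0 1) := by fun_prop
    exact ((hd.add (h3.mul hd')).mul_const _).sub (hd.pow 2)
  have hn0 : n w = 0 := by simp only [hn]; ring
  have hn1 : deriv n w = 0 := by
    have e1 := (hd.differentiableAt hU).hasDerivAt
    have e2 := (hd'.differentiableAt hU).hasDerivAt
    have e3 := ((e1.add (((hasDerivAt_id w).sub_const w).mul e2)).mul_const (h w)).sub (e1.pow 2)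
    refine e3.deriv.trans ?_
    simp only [id]
    norm_num
    ring
  -- Dividing twice by $z-w$ keeps holomorphy, so $k$ is the holomorphic extension of
  -- $n(z)/(z-w)^2$.
  set k : ℂ → ℂ := dslope (dslope n w) w with hk
  have hkd : DifferentiableOn ℂ k (ball 0 1) :=
    (Complex.differentiableOn_dslope hU).2 ((Complex.differentiableOn_dslope hU).2 hnd)
  have hkn : ∀ z, (z - w) ^ 2 * k z = n z := by
    intro z
    have e1 : (z - w) * k z = dslope n w z - dslope n w w := sub_smul_dslope (dslope n w) w z
    have e2 : (z - w) * dslope n w z = n z - n w := sub_smul_dslope n w z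
    rw [dslope_same, hn1, sub_zero] at e1
    rw [hn0, sub_zero] at e2
    rw [sq, mul_assoc, e1, e2]
  refine ⟨fun z => k z / h z ^ 2, hkd.div (hd.pow 2) fun z hz => pow_ne_zero 2 (hne z hz),
    fun z hz hzw => ?_⟩
  have e1 : z - w ≠ 0 := sub_ne_zero.2 hzw
  have e2 := hne z hz
  have e3 := hkn z
  simp only [hn] at e3
  simp only [F]
  rw [hder z hz, ← hw', ← hsub z]
  field_simp
  linear_combination -e3

/-- By injectivity `fn φ` is not constant on the disk, so its derivative is a nonzero analytic
function and its zeros are discrete, hence null. The statement almost everywhere is enough, since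
only almost every slice of `F φ` is used. -/
theorem ae_deriv_fn_ne_zero (φ : CEemb) : ∀ᵐ z ∂μD, deriv (fn φ) z ≠ 0 := by
  rw [ae_mu_iff]
  have ha : AnalyticOnNhd ℂ (deriv (fn φ)) (ball 0 1) :=
    (fn_differentiableOn_deriv φ).analyticOnNhd isOpen_ball
  have hpre : IsPreconnected (ball (0 : ℂ) 1) := (convex_ball 0 1).isPreconnected
  have hex : ∃ x ∈ ball (0 : ℂ) 1, deriv (fn φ) x ≠ 0 := by
    by_contra! hc
    have h0 : (0 : ℂ) ∈ ball (0 : ℂ) 1 := by simp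
    have h1 : (2⁻¹ : ℂ) ∈ ball (0 : ℂ) 1 := by simp; norm_num
    have := isOpen_ball.is_const_of_deriv_eq_zero hpre (fn_differentiableOn φ)
      (fun z hz => hc z hz) h0 h1
    have := fn_injOn φ h0 h1 this
    norm_num at this
  obtain ⟨x, hx, hx0⟩ := hex
  have := ha.preimage_zero_mem_codiscreteWithin hx0 hx
    ⟨⟨0, by simp⟩, hpre⟩
  exact ae_restrict_le_codiscreteWithin measurableSet_ball this

theorem T_ae_eq (φ : CEemb) (f : A2) :
    (T φ f : Lp ℂ 2 μD) =ᵐ[μD] fun z => deriv (fn φ) z * hol f (fn φ z) :=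
  (memLp_pull φ f).coeFn_toLp

theorem hol_T (φ : CEemb) (f : A2) {z : ℂ} (hz : z ∈ ball (0 : ℂ) 1) :
    hol (T φ f) z = deriv (fn φ) z * hol f (fn φ z) :=
  hol_eqOn _ (pull_aux φ f) (T_ae_eq φ f) hz

theorem A2_ext {f g : A2} (h : Set.EqOn (hol f) (hol g) (ball 0 1)) : f = g := by
  refine Subtype.ext (Lp.ext ?_)
  filter_upwards [coe_ae_eq_hol f, coe_ae_eq_hol g, ae_mem_ball] with z h1 h2 h3
  rw [h1, h2, h h3]

theorem fn_one_eqOn : Set.EqOn (fn 1) id (ball 0 1) := by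
  intro z hz
  lift z to 𝔻 using by simpa using hz
  exact fn_coe 1 z

theorem T_one : T 1 = 1 := by
  refine ContinuousLinearMap.ext fun f => A2_ext fun z hz => ?_
  have h : fn 1 =ᶠ[𝓝 z] id := fn_one_eqOn.eventuallyEq_of_mem (isOpen_ball.mem_nhds hz)
  rw [hol_T 1 f hz, h.deriv_eq, deriv_id, one_mul, fn_one_eqOn hz]
  rfl

theorem T_mul (φ ψ : CEemb) : T (φ * ψ) = T ψ * T φ := by
  refine ContinuousLinearMap.ext fun f => A2_ext fun z hz => ?_
  rw [mul_apply_eq_comp, hol_T _ _ hz, hol_T _ _ hz, hol_T _ _ (fn_mapsTo ψ hz),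
    deriv_fn_mul φ ψ hz, fn_mul_eqOn φ ψ hz, Function.comp_apply]
  ring

theorem norm_T_le (φ : CEemb) : ‖T φ‖ ≤ 1 := LinearMap.mkContinuous_norm_le _ zero_le_one _

theorem conjJ_one : conjJ 1 = 1 := by
  refine Subtype.ext (funext fun z => ?_)
  exact star_star z

theorem conjJ_mul (φ ψ : CEemb) : conjJ (φ * ψ) = conjJ φ * conjJ ψ := by
  refine Subtype.ext (funext fun z => ?_)
  change star (φ.1 (ψ.1 (star z))) = star (φ.1 (star (star (ψ.1 (star z)))))
  rw [star_star]

theorem norm_rhoCl_le (φ : CEemb) : ‖rhoCl φ‖ ≤ 1 := by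
  rw [rhoCl, LinearIsometryEquiv.norm_map]
  exact norm_T_le _

/-- `ρ_cl` as a representation. -/
def rhoClHom : CEHS →* (A2 →L[ℂ] A2) where
  toFun φ := rhoCl φ
  map_one' := by
    change ContinuousLinearMap.adjoint (T (conjJ 1)) = 1
    rw [conjJ_one, T_one, ← ContinuousLinearMap.star_eq_adjoint, star_one]
  map_mul' φ ψ := by
    change ContinuousLinearMap.adjoint (T (conjJ (φ.1 * ψ.1))) = rhoCl φ * rhoCl ψ
    rw [conjJ_mul, T_mul, ← ContinuousLinearMap.star_eq_adjoint, star_mul]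
    rfl

theorem lintegral_sq_lt_top {α : Type*} {m : MeasurableSpace α} {μ : Measure α} {f : α → ℂ}
    (hf : MemLp f 2 μ) : ∫⁻ x, ‖f x‖ₑ ^ 2 ∂μ < ∞ := by
  rw [← eLpNorm_two_sq]
  exact ENNReal.pow_lt_top hf.2

theorem memLp_two_of_lintegral {α : Type*} {m : MeasurableSpace α} {μ : Measure α} {f : α → ℂ}
    (hf : AEStronglyMeasurable f μ) (h : ∫⁻ x, ‖f x‖ₑ ^ 2 ∂μ < ∞) : MemLp f 2 μ := by
  rw [← eLpNorm_two_sq] at h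
  refine ⟨hf, lt_of_not_ge fun htop => ?_⟩
  rw [top_le_iff.1 htop] at h
  simp at h

theorem ae_memLp_slice {G : ℂ × ℂ → ℂ} (hG : Measurable G) (h : MemLp G 2 (μD.prod μD)) :
    ∀ᵐ w ∂μD, MemLp (fun z => G (z, w)) 2 μD := by
  have h1 := lintegral_sq_lt_top h
  rw [lintegral_prod_symm _ (by fun_prop)] at h1
  have hm : Measurable fun w => ∫⁻ z, ‖G (z, w)‖ₑ ^ 2 ∂μD :=
    Measurable.lintegral_prod_left' (f := fun p : ℂ × ℂ => ‖G p‖ₑ ^ 2) (by fun_prop)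
  filter_upwards [ae_lt_top hm h1.ne] with w hw
  exact memLp_two_of_lintegral (hG.comp measurable_prodMk_right).aestronglyMeasurable hw

/-- This is $\langle T_\psi G,f\rangle=\langle G,T_\psi^*f\rangle$ written as integrals, for the
Bergman element $G$ represented by `g`. -/
theorem integral_conj_mul_adjoint_T (ψ : CEemb) {g : ℂ → ℂ} (hg : DifferentiableOn ℂ g (ball 0 1))
    (hg2 : MemLp g 2 μD) (f : A2) :
    ∫ z, conj (deriv (fn ψ) z * g (fn ψ z)) * (f : Lp ℂ 2 μD) z ∂μD =
      ∫ z, conj (g z) * (ContinuousLinearMap.adjoint (T ψ) f : Lp ℂ 2 μD) z ∂μD := by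
  let G : A2 := ⟨hg2.toLp g, g, hg, hg2.coeFn_toLp⟩
  have h := (ContinuousLinearMap.adjoint_inner_right (T ψ) G f).symm
  rw [Submodule.coe_inner, Submodule.coe_inner, L2.inner_def, L2.inner_def] at h
  refine Eq.trans ?_ (h.trans ?_)
  · refine integral_congr_ae ?_
    filter_upwards [T_ae_eq ψ G, ae_mem_ball] with z h1 h2
    rw [h1, RCLike.inner_apply, hol_eqOn G hg hg2.coeFn_toLp (fn_mapsTo ψ h2), mul_comm]
  · refine integral_congr_ae ?_
    filter_upwards [hg2.coeFn_toLp] with z h1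
    change inner ℂ (hg2.toLp g z) _ = _
    rw [h1, RCLike.inner_apply, mul_comm]

theorem ae_ne (w : ℂ) : ∀ᵐ z ∂μD, z ≠ w := by
  rw [ae_mu_iff]
  exact ae_restrict_of_ae (Measure.ae_ne volume w)

/-- The slice differs from a holomorphic function at most at `z = w`, so
`integral_conj_mul_adjoint_T` applies to that function. -/
theorem integral_conj_F_slice (φ ψ : CEemb) {w : ℂ} (hw : w ∈ ball (0 : ℂ) 1)
    (h0 : deriv (fn φ) w ≠ 0) (hF : MemLp (fun z => F φ (z, w)) 2 μD) (f : A2) :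
    ∫ z, conj (deriv (fn ψ) z * F φ (fn ψ z, w)) * (f : Lp ℂ 2 μD) z ∂μD =
      ∫ z, conj (F φ (z, w)) * (ContinuousLinearMap.adjoint (T ψ) f : Lp ℂ 2 μD) z ∂μD := by
  obtain ⟨g, hg, hFg⟩ := exists_F_eq φ hw h0
  have hae : (fun z => F φ (z, w)) =ᵐ[μD] g := by
    filter_upwards [ae_mem_ball, ae_ne w] with z h1 h2 using hFg z h1 h2
  -- After composition with `ψ` the exceptional set is the preimage of `w`, at most one point by
  -- injectivity.
  have hne : ∀ᵐ z ∂μD, fn ψ z ≠ w := by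
    by_cases h : ∃ z₀ ∈ ball (0 : ℂ) 1, fn ψ z₀ = w
    · obtain ⟨z₀, hz₀, rfl⟩ := h
      filter_upwards [ae_ne z₀, ae_mem_ball] with z h1 h2 h3
      exact h1 (fn_injOn ψ h2 hz₀ h3)
    · push Not at h
      filter_upwards [ae_mem_ball] with z hz using h z hz
  refine Eq.trans ?_ ((integral_conj_mul_adjoint_T ψ hg ((memLp_congr_ae hae).1 hF) f).trans ?_)
  · refine integral_congr_ae ?_
    filter_upwards [hne, ae_mem_ball] with z h1 h2
    rw [hFg _ (fn_mapsTo ψ h2) h1]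
  · refine integral_congr_ae ?_
    filter_upwards [hae] with z h1
    rw [← h1]

end Cocycle

/-! ### The cocycle identity for the pairing -/

section CocycleIntegral

theorem memLp_F_comp (φ ψ : CEemb) (hF : MemLp (F φ) 2 (μD.prod μD)) :
    MemLp (fun p : ℂ × ℂ => deriv (fn ψ) p.1 * deriv (fn ψ) p.2 * F φ (fn ψ p.1, fn ψ p.2)) 2
      (μD.prod μD) := by
  have h1 := measurable_fn ψ
  have h2 := measurable_deriv (fn ψ)
  have h3 := measurable_F φ
  refine memLp_two_of_lintegral (Measurable.aestronglyMeasurable (by fun_prop)) ?_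
  simp only [enorm_mul, mul_pow]
  exact (lintegral_F_comp_le ψ (h3.enorm.pow_const 2)).trans_lt (lintegral_sq_lt_top hF)

/-- The intermediate kernel $(1\otimes T_\psi)F_\phi$, needed because the adjoints are moved across
one variable at a time. The bound is the change of variables in the second variable alone. -/
theorem memLp_F_comp_snd (φ ψ : CEemb) (hF : MemLp (F φ) 2 (μD.prod μD)) :
    MemLp (fun p : ℂ × ℂ => deriv (fn ψ) p.2 * F φ (p.1, fn ψ p.2)) 2 (μD.prod μD) := by
  have h1 := measurable_fn ψ
  have h2 := measurable_deriv (fn ψ)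
  have h3 := measurable_F φ
  refine memLp_two_of_lintegral (Measurable.aestronglyMeasurable (by fun_prop)) ?_
  refine lt_of_le_of_lt ?_ (lintegral_sq_lt_top hF)
  rw [lintegral_prod _ (by fun_prop), lintegral_prod _ (by fun_prop)]
  refine lintegral_mono fun z => ?_
  simp only [enorm_mul, mul_pow]
  exact fn_lintegral_comp_le ψ fun w => ‖F φ (z, w)‖ₑ ^ 2

theorem integrable_conj_mul_prod {G : ℂ × ℂ → ℂ} (hG : MemLp G 2 (μD.prod μD))
    (f g : Lp ℂ 2 μD) :
    Integrable (fun p : ℂ × ℂ => conj (G p) * (f p.1 * g p.2)) (μD.prod μD) :=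
  MemLp.integrable_mul (p := 2) (q := 2) hG.star (memLp_mul_prod f g)

/-- The change of variables formula dual to `T_ψ ⊗ T_ψ`, applied to `F_φ`. -/
theorem integral_conj_F_comp (φ ψ : CEemb) (hF : MemLp (F φ) 2 (μD.prod μD)) (f g : A2) :
    ∫ p : ℂ × ℂ, conj (deriv (fn ψ) p.1 * deriv (fn ψ) p.2 * F φ (fn ψ p.1, fn ψ p.2)) *
        ((f : Lp ℂ 2 μD) p.1 * (g : Lp ℂ 2 μD) p.2) ∂(μD.prod μD) =
      ∫ p : ℂ × ℂ, conj (F φ p) *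
        ((ContinuousLinearMap.adjoint (T ψ) f : Lp ℂ 2 μD) p.1 *
          (ContinuousLinearMap.adjoint (T ψ) g : Lp ℂ 2 μD) p.2) ∂(μD.prod μD) := by
  set f' := ContinuousLinearMap.adjoint (T ψ) f with hf'
  set g' := ContinuousLinearMap.adjoint (T ψ) g with hg'
  have hm1 := measurable_fn ψ
  have hm2 := measurable_deriv (fn ψ)
  have hm3 := measurable_F φ
  have hG := memLp_F_comp_snd φ ψ hF
  have hslice := ae_memLp_slice (by fun_prop) hG
  have hslice' := ae_memLp_slice hm3 hF
  calc _ = ∫ p : ℂ × ℂ, conj (deriv (fn ψ) p.2 * F φ (p.1, fn ψ p.2)) *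
        ((f' : Lp ℂ 2 μD) p.1 * (g : Lp ℂ 2 μD) p.2) ∂(μD.prod μD) := by
        rw [integral_prod_symm _ (integrable_conj_mul_prod (memLp_F_comp φ ψ hF) _ _),
          integral_prod_symm _ (integrable_conj_mul_prod hG _ _)]
        refine integral_congr_ae ?_
        -- The slice is taken at `fn ψ w`. Nonvanishing of
        -- $(\varphi\psi)'(w)=\varphi'(\psi(w))\psi'(w)$ supplies both conditions:
        -- $\varphi'(\psi(w))\ne0$ makes the singularity removable, and $\psi'(w)\ne0$ allows
        -- dividing to get $F_\varphi(\cdot,\psi(w))\in L^2$.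
        filter_upwards [hslice, ae_deriv_fn_ne_zero (φ * ψ), ae_mem_ball] with w h1 h2 h3
        rw [deriv_fn_mul φ ψ h3] at h2
        have h4 := right_ne_zero_of_mul h2
        have h5 : MemLp (fun z => F φ (z, fn ψ w)) 2 μD := by
          have := h1.const_mul (deriv (fn ψ) w)⁻¹
          simpa only [inv_mul_cancel_left₀ h4] using this
        have h6 := integral_conj_F_slice φ ψ (fn_mapsTo ψ h3) (left_ne_zero_of_mul h2) h5 f
        have e1 := integral_const_mul (μ := μD) (conj (deriv (fn ψ) w) * (g : Lp ℂ 2 μD) w)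
          fun z => conj (deriv (fn ψ) z * F φ (fn ψ z, fn ψ w)) * (f : Lp ℂ 2 μD) z
        have e2 := integral_const_mul (μ := μD) (conj (deriv (fn ψ) w) * (g : Lp ℂ 2 μD) w)
          fun z => conj (F φ (z, fn ψ w)) * (f' : Lp ℂ 2 μD) z
        refine Eq.trans ?_ ((e1.trans (congrArg _ h6)).trans (e2.symm.trans ?_))
        · congr 1
          funext z
          simp only [map_mul]
          ring
        · congr 1
          funext z
          simp only [map_mul]
          ring
    _ = _ := by
        rw [integral_prod _ (integrable_conj_mul_prod hG _ _),
          integral_prod _ (integrable_conj_mul_prod hF _ _)]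
        refine integral_congr_ae ?_
        -- Now the first variable is fixed; the symmetry of $F_\varphi$ turns the slice in the
        -- second variable into one already treated.
        filter_upwards [hslice', ae_deriv_fn_ne_zero φ, ae_mem_ball] with z h1 h2 h3
        have h6 := integral_conj_F_slice φ ψ h3 h2 h1 g
        have e1 := integral_const_mul (μ := μD) ((f' : Lp ℂ 2 μD) z)
          fun w => conj (deriv (fn ψ) w * F φ (fn ψ w, z)) * (g : Lp ℂ 2 μD) w
        have e2 := integral_const_mul (μ := μD) ((f' : Lp ℂ 2 μD) z)
          fun w => conj (F φ (w, z)) * (g' : Lp ℂ 2 μD) w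
        refine Eq.trans ?_ ((e1.trans (congrArg _ h6)).trans (e2.symm.trans ?_))
        · congr 1
          funext w
          rw [F_swap φ z (fn ψ w)]
          ring
        · congr 1
          funext w
          rw [F_swap φ z w]
          ring

theorem pairing_htmul (φ : CEHS) (f g : A2) :
    pairing φ (htmul f g) = ∫ p : ℂ × ℂ, conj (F (conjJ φ.1) p) *
      ((f : Lp ℂ 2 μD) p.1 * (g : Lp ℂ 2 μD) p.2) ∂(μD.prod μD) := by
  rw [pairing_apply, toL2_htmul]
  refine integral_congr_ae ?_
  filter_upwards [(memLp_mul_prod (f : Lp ℂ 2 μD) g).coeFn_toLp] with p hp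
  rw [hp, F_J, Complex.conj_conj]

/-- As $\mathcal J$ is multiplicative, the chain rule `F_mul` for $\mathcal J\phi$, $\mathcal J\psi$
splits the kernel. In its first term the two adjoints $T_{\mathcal
J\psi}^*=\rho_{\mathrm{cl}}(\psi)$ land on `f` and `g`. -/
theorem pairing_mul (φ ψ : CEHS) (f g : A2) :
    pairing (φ * ψ) (htmul f g) =
      pairing φ (htmul (rhoCl ψ f) (rhoCl ψ g)) + pairing ψ (htmul f g) := by
  rw [pairing_htmul, pairing_htmul, pairing_htmul, rhoCl,
    ← integral_conj_F_comp (conjJ φ.1) (conjJ ψ.1) (memLp_F_J φ), ← integral_add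
      (integrable_conj_mul_prod (memLp_F_comp _ _ (memLp_F_J φ)) _ _)
      (integrable_conj_mul_prod (memLp_F_J ψ) _ _)]
  refine integral_congr_ae ?_
  filter_upwards [ae_prod_mem_ball] with p hp
  change conj (F (conjJ (φ.1 * ψ.1)) p) * _ = _
  rw [conjJ_mul, F_mul _ _ hp.1 hp.2, map_add, add_mul]

end CocycleIntegral

/-! ### Möbius maps: vanishing kernel, isometry, continuity -/

section Moebius

theorem fn_moebius (u : Circle) (α : 𝔻) {z : ℂ} (hz : z ∈ ball (0 : ℂ) 1) :
    fn (moebius u α).1 z = u * ((z - α) / (1 - conj (α : ℂ) * z)) :=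
  ext_moebius_eqOn u α hz

theorem deriv_fn_moebius (u : Circle) (α : 𝔻) {z : ℂ} (hz : z ∈ ball (0 : ℂ) 1) :
    deriv (fn (moebius u α).1) z =
      u * (1 - conj (α : ℂ) * α) / (1 - conj (α : ℂ) * z) ^ 2 := by
  lift z to 𝔻 using by simpa using hz
  exact (hasDerivAt_ext_moebius u α z).deriv

/-- Möbius maps satisfy $(\varphi(z)-\varphi(w))^2=\varphi'(z)\varphi'(w)(z-w)^2$. -/
theorem F_moebius (u : Circle) (α : 𝔻) {p : ℂ × ℂ} (h1 : p.1 ∈ ball (0 : ℂ) 1)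
    (h2 : p.2 ∈ ball (0 : ℂ) 1) : F (moebius u α).1 p = 0 := by
  obtain ⟨z, w⟩ := p
  simp only [F, deriv_fn_moebius u α h1, deriv_fn_moebius u α h2, fn_moebius u α h1,
    fn_moebius u α h2]
  lift z to 𝔻 using by simpa using h1
  lift w to 𝔻 using by simpa using h2
  rw [moebius_sub]
  have h1 := one_sub_conj_mul_ne_zero α z
  have h2 := one_sub_conj_mul_ne_zero α w
  have h3 := one_sub_conj_mul_ne_zero α α
  have h4 := u.coe_ne_zero
  -- On the diagonal both quotients have denominator zero and so take the value 0.
  by_cases h : (z : ℂ) - w = 0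
  · simp [h]
  · field_simp
    ring

theorem pairing_moebius (u : Circle) (α : 𝔻) : pairing (moebius u α) = 0 := by
  refine ContinuousLinearMap.ext fun P => ?_
  rw [pairing_apply]
  refine integral_eq_zero_of_ae ?_
  filter_upwards [ae_prod_mem_ball] with p hp
  rw [F_moebius u α (by simpa using hp.1) (by simpa using hp.2), zero_mul]
  rfl

/-- Solving $w=u(z-\alpha)/(1-\bar\alpha z)$ for $z$ gives $z=\bar u(w+u\alpha)/(1+\bar u\bar\alpha
w)$. -/
theorem moebius_mul_moebius_inv (u : Circle) (α : 𝔻) :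
    moebius u α * moebius u⁻¹ (-(u • α)) = 1 := by
  refine CEHS_ext fun z => UnitDisc.coe_injective ?_
  change (moebiusFun u α (moebiusFun u⁻¹ (-(u • α)) z) : ℂ) = z
  have hd1 := one_sub_conj_mul_ne_zero (-(u • α)) z
  have hd2 := one_sub_conj_mul_ne_zero α (moebiusFun u⁻¹ (-(u • α)) z)
  have hd3 := one_sub_conj_mul_ne_zero α α
  have hu : (u : ℂ) * conj (u : ℂ) = 1 := by
    rw [Complex.mul_conj, Complex.normSq_eq_norm_sq, Circle.norm_coe]; simp
  have hu0 := u.coe_ne_zero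
  rw [coe_moebiusFun u α]
  rw [coe_moebiusFun] at hd2 ⊢
  simp only [UnitDisc.coe_neg, UnitDisc.coe_circle_smul, Circle.coe_inv_eq_conj, map_neg, map_mul]
    at hd1 hd2 ⊢
  -- Conjugates become independent variables; the only relation retained is $u\bar u=1$, besides the
  -- nonvanishing of denominators.
  generalize (α : ℂ) = a at *
  generalize conj a = b at *
  generalize (u : ℂ) = c at *
  generalize conj c = d at *
  generalize (z : ℂ) = x at *
  have e1 : d * ((x - -(c * a)) / (1 - -(d * b) * x)) - a
      = d * x * (1 - b * a) / (1 - -(d * b) * x) := by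
    rw [eq_div_iff hd1, sub_mul, mul_assoc, div_mul_cancel₀ _ hd1]
    linear_combination a * hu
  have e2 : 1 - b * (d * ((x - -(c * a)) / (1 - -(d * b) * x)))
      = (1 - b * a) / (1 - -(d * b) * x) := by
    rw [eq_div_iff hd1, sub_mul, mul_assoc, mul_assoc, div_mul_cancel₀ _ hd1]
    linear_combination -(a * b) * hu
  rw [e1, e2, div_div_div_cancel_right₀ hd1, mul_div_assoc, div_self hd3]
  linear_combination x * hu

theorem exists_inv_of_mem_PSU11 {g : CEHS} (hg : g ∈ PSU11) :
    ∃ h : CEHS, g * h = 1 ∧ h * g = 1 := by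
  obtain ⟨⟨u, α⟩, rfl⟩ := hg
  refine ⟨moebius u⁻¹ (-(u • α)), moebius_mul_moebius_inv u α, ?_⟩
  have h := moebius_mul_moebius_inv u⁻¹ (-(u • α))
  have e : -(u⁻¹ • -(u • α)) = α := by
    apply UnitDisc.coe_injective
    simp only [UnitDisc.coe_neg, UnitDisc.coe_circle_smul]
    rw [mul_neg, neg_neg, ← mul_assoc, ← Circle.coe_mul]
    simp
  rwa [inv_inv, e] at h

/-- Every $\rho_{\mathrm{cl}}(\phi)$ is a contraction. Here the inverse is one as well, which forces
an isometry. -/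
theorem norm_rhoCl_of_mem_PSU11 {g : CEHS} (hg : g ∈ PSU11) (f : A2) : ‖rhoCl g f‖ = ‖f‖ := by
  obtain ⟨h, -, hh⟩ := exists_inv_of_mem_PSU11 hg
  have hle : ∀ (φ : CEHS) (f : A2), ‖rhoCl φ f‖ ≤ ‖f‖ := fun φ f => by
    simpa using (rhoCl φ.1).le_of_opNorm_le (norm_rhoCl_le φ.1) f
  refine le_antisymm (hle g f) ?_
  have h1 : rhoCl h (rhoCl g f) = f := by
    have := map_mul rhoClHom h g
    rw [hh, map_one] at this
    exact (DFunLike.congr_fun this f).symm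
  conv_lhs => rw [← h1]
  exact hle h _

theorem inner_rhoCl_of_mem_PSU11 {g : CEHS} (hg : g ∈ PSU11) (f f' : A2) :
    inner ℂ (rhoCl g f) (rhoCl g f') = inner ℂ f f' := by
  let L : A2 →ₗᵢ[ℂ] A2 := ⟨(rhoCl g).toLinearMap, norm_rhoCl_of_mem_PSU11 hg⟩
  exact L.inner_map_map f f'

/-- Point evaluation on the Bergman space as a bounded functional. -/
theorem exists_evaluation_vector {w : ℂ} (hw : w ∈ ball (0 : ℂ) 1) :
    ∃ K : A2, ∀ f : A2, inner ℂ K f = hol f w := by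
  obtain ⟨R, hR, hc⟩ := Metric.nhds_basis_closedBall.mem_iff.1 (isOpen_ball.mem_nhds hw)
  let L : A2 →L[ℂ] ℂ := LinearMap.mkContinuous
    { toFun := fun f => hol f w
      map_add' := fun f g => hol_add f g hw
      map_smul' := fun c f => hol_smul c f hw } (R ^ 2)⁻¹ fun f => norm_hol_le f hR hc
  refine ⟨(InnerProductSpace.toDual ℂ A2).symm L, fun f => ?_⟩
  rw [InnerProductSpace.toDual_symm_apply]
  rfl

theorem continuous_hol_T_moebius (f : A2) {w : ℂ} (hw : w ∈ ball (0 : ℂ) 1) :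
    Continuous fun t : Circle × 𝔻 => hol (T (conjJ (moebius t.1 t.2).1) f) w := by
  have hw' : conj w ∈ ball (0 : ℂ) 1 := by simpa using hw
  have hd : ∀ t : Circle × 𝔻, deriv (fn (conjJ (moebius t.1 t.2).1)) w
      = conj (t.1 * (1 - conj (t.2 : ℂ) * t.2) / (1 - conj (t.2 : ℂ) * conj w) ^ 2) := by
    intro t
    rw [fn_conjJ, deriv_conj_conj, ← deriv_fn_moebius t.1 t.2 hw']
    rfl
  have hv : ∀ t : Circle × 𝔻, fn (conjJ (moebius t.1 t.2).1) w
      = conj (t.1 * ((conj w - t.2) / (1 - conj (t.2 : ℂ) * conj w))) := by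
    intro t
    rw [fn_conjJ, ← fn_moebius t.1 t.2 hw']
    rfl
  have hne : ∀ t : Circle × 𝔻, 1 - conj (t.2 : ℂ) * conj w ≠ 0 := by
    intro t
    lift w to 𝔻 using by simpa using hw
    exact one_sub_conj_mul_ne_zero t.2 (star w)
  have hα : Continuous fun t : Circle × 𝔻 => (t.2 : ℂ) :=
    UnitDisc.continuous_coe.comp continuous_snd
  have hu : Continuous fun t : Circle × 𝔻 => (t.1 : ℂ) :=
    continuous_subtype_val.comp continuous_fst
  have hα' : Continuous fun t : Circle × 𝔻 => conj (t.2 : ℂ) := Complex.continuous_conj.comp hα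
  have hden : Continuous fun t : Circle × 𝔻 => 1 - conj (t.2 : ℂ) * conj w := by fun_prop
  have hcd : Continuous fun t : Circle × 𝔻 => deriv (fn (conjJ (moebius t.1 t.2).1)) w := by
    simp only [hd]
    exact Complex.continuous_conj.comp ((hu.mul (continuous_const.sub (hα'.mul hα))).div
      (hden.pow 2) fun t => pow_ne_zero 2 (hne t))
  have hcv : Continuous fun t : Circle × 𝔻 => fn (conjJ (moebius t.1 t.2).1) w := by
    simp only [hv]
    exact Complex.continuous_conj.comp (hu.mul ((continuous_const.sub hα).div hden hne))
  refine (hcd.mul ((hol_differentiableOn f).continuousOn.comp_continuous hcv fun t =>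
    fn_mapsTo _ hw)).congr fun t => (hol_T _ f hw).symm

/-- The vectors `x` with this property form a subspace containing all reproducing kernels, where the
inner product is a point value. A vector orthogonal to them vanishes pointwise, so the subspace is
dense, and $\|T_\phi\|\le1$ makes the approximation uniform in `t`. -/
theorem continuous_inner_T_moebius (x f : A2) :
    Continuous fun t : Circle × 𝔻 => inner ℂ x (T (conjJ (moebius t.1 t.2).1) f) := by
  let S : Submodule ℂ A2 :=
    { carrier := {x | Continuous fun t : Circle × 𝔻 =>
        inner ℂ x (T (conjJ (moebius t.1 t.2).1) f)}
      add_mem' := fun {x y} hx hy => by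
        simp only [Set.mem_ofPred_eq, inner_add_left] at hx hy ⊢
        exact hx.add hy
      zero_mem' := by
        simp only [Set.mem_ofPred_eq, inner_zero_left]
        exact continuous_const
      smul_mem' := fun c x hx => by
        simp only [Set.mem_ofPred_eq, inner_smul_left] at hx ⊢
        exact continuous_const.mul hx }
  have hS : S.topologicalClosure = ⊤ := by
    rw [Submodule.topologicalClosure_eq_top_iff, Submodule.eq_bot_iff]
    intro y hy
    refine A2_ext fun w hw => ?_
    obtain ⟨K, hK⟩ := exists_evaluation_vector hw
    have hKS : K ∈ S := by
      change Continuous fun t : Circle × 𝔻 => inner ℂ K (T (conjJ (moebius t.1 t.2).1) f)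
      simp only [hK]
      exact continuous_hol_T_moebius f hw
    rw [← hK, ← hK, (Submodule.mem_orthogonal S y).1 hy K hKS, inner_zero_right]
  have hx : x ∈ S.topologicalClosure := hS ▸ Submodule.mem_top
  refine continuous_of_uniform_approx_of_continuous fun u hu => ?_
  obtain ⟨ε, hε, hεu⟩ := Metric.mem_uniformity_dist.1 hu
  -- The added 1 keeps the denominator positive when `f = 0`.
  obtain ⟨y, hy, hxy⟩ := Metric.mem_closure_iff.1 hx (ε / (‖f‖ + 1)) (by positivity)
  refine ⟨_, hy, fun t => hεu ?_⟩
  have h2 := inner_sub_left (𝕜 := ℂ) x y (T (conjJ (moebius t.1 t.2).1) f)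
  rw [dist_eq_norm, ← h2]
  have h1 : ‖T (conjJ (moebius t.1 t.2).1) f‖ ≤ ‖f‖ := by
    simpa using (T (conjJ (moebius t.1 t.2).1)).le_of_opNorm_le (norm_T_le _) f
  rw [dist_eq_norm, lt_div_iff₀ (by positivity)] at hxy
  refine (norm_inner_le_norm _ _).trans_lt (lt_of_le_of_lt ?_ hxy)
  gcongr
  linarith

theorem moebius_mem_PSU11 (u : Circle) (α : 𝔻) : moebius u α ∈ PSU11 := ⟨(u, α), rfl⟩

/-- Taking adjoints turns weak continuity of $T$ into that of $\rho_{\mathrm{cl}}$, and isometry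
upgrades it to strong continuity. -/
theorem continuous_rhoCl_moebius (f : A2) :
    Continuous fun t : Circle × 𝔻 => rhoCl (moebius t.1 t.2) f := by
  refine continuous_of_inner_of_weak (A := fun t : Circle × 𝔻 => rhoCl (moebius t.1 t.2))
    (fun t a => norm_rhoCl_of_mem_PSU11 (moebius_mem_PSU11 _ _) a) (fun a b => ?_) f
  simp only [rhoCl, ContinuousLinearMap.adjoint_inner_left]
  exact continuous_inner_T_moebius a b

end Moebius

/-! ### Assembly of the representations on the Bergman space -/

theorem pairing_one : pairing 1 = 0 := by
  obtain ⟨⟨u, α⟩, h⟩ := PSU11.one_mem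
  rw [← h]
  exact pairing_moebius u α

theorem pairing_of_mem_PSU11 {g : CEHS} (hg : g ∈ PSU11) : pairing g = 0 := by
  obtain ⟨⟨u, α⟩, rfl⟩ := hg
  exact pairing_moebius u α

/-- The representation on `Sym A²(𝔻)`. -/
def rho : CEHS →* Module.End ℂ (FockSym A2) :=
  fockRep rhoClHom pairing (fun a => by rw [pairing_one]; rfl) fun φ ψ a => pairing_mul φ ψ a a

/-- The representation on the symmetric tensors of degree at most `k`. -/
def rhoFil (k : ℕ) : CEHS →* (SymFil A2 k →L[ℂ] SymFil A2 k) :=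
  symFilRep rhoClHom pairing (fun a => by rw [pairing_one]; rfl)
    (fun φ ψ a => pairing_mul φ ψ a a) k

theorem rhoFil_mem_unitary (k : ℕ) {g : CEHS} (hg : g ∈ PSU11) :
    rhoFil k g ∈ unitary (SymFil A2 k →L[ℂ] SymFil A2 k) :=
  symFilRep_mem_unitary _ _ ((exists_inv_of_mem_PSU11 hg).imp fun _ => And.left)
    (inner_rhoCl_of_mem_PSU11 hg) (fun a => by rw [pairing_of_mem_PSU11 hg]; rfl) k

theorem continuous_rhoFil (k : ℕ) (x : SymFil A2 k) :
    Continuous fun g : PSU11 => rhoFil k g x := by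
  -- The topology of `PSU11` is coinduced, so continuity is tested on the parameters $(u,\alpha)$.
  refine continuous_coinduced_dom.2 ?_
  exact continuous_symFilOp (A := fun t : Circle × 𝔻 => rhoCl (moebius t.1 t.2))
    (β := fun t : Circle × 𝔻 => pairing (moebius t.1 t.2))
    (fun t a b => inner_rhoCl_of_mem_PSU11 (moebius_mem_PSU11 _ _) a b)
    continuous_rhoCl_moebius (fun t a => by rw [pairing_moebius]; rfl) k x

end BergmanCE

end

open BergmanCE
theorem theorem2 :
    ∃ ρ : CEHS →* Module.End ℂ (FockSym A2),
      (∀ (φ : CEHS) (x : FockSym A2), FockSym.incl (ρ φ x) = rhoTensor φ (FockSym.incl x)) ∧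
      ∀ k : ℕ, ∃ ρk : CEHS →* (SymFil A2 k →L[ℂ] SymFil A2 k),
        (∀ (φ : CEHS) (x : SymFil A2 k), SymFil.incl k (ρk φ x) = ρ φ (SymFil.incl k x)) ∧
        ∃ U : PSU11 →* unitary (SymFil A2 k →L[ℂ] SymFil A2 k),
          (∀ g : PSU11, (U g : SymFil A2 k →L[ℂ] SymFil A2 k) = ρk (g : CEHS)) ∧
          ∀ x : SymFil A2 k, Continuous fun g : PSU11 =>
            (U g : SymFil A2 k →L[ℂ] SymFil A2 k) x := by
  refine ⟨rho, fun φ x => incl_fockOp _ _ x, fun k => ⟨rhoFil k,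
    fun φ x => incl_symFilOp _ _ k x, ?_⟩⟩
  exact ⟨((rhoFil k).comp PSU11.subtype).codRestrict (unitary (SymFil A2 k →L[ℂ] SymFil A2 k))
    (fun g => rhoFil_mem_unitary k g.2), fun g => rfl, fun x => continuous_rhoFil k x⟩
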